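/- **Soundness of LINA.** Let $\mathcal{DV}$ and $\mathcal{RV}$ be disjoint sets of deterministic and randomized program variables; each variable has a preordered set of values. For $S\subseteq\mathcal{RV}$, $\mathrm{Mem}[S]$ is the set of well-typed assignments of values to the variables in $S$ (ordered pointwise), $\mathcal D(X)$ is the set of countably supported probability distributions on $X$, and $\pi_S$ denotes marginalization to $S$. A *configuration* is a pair $(\sigma,\mu)$ with $\sigma\in\mathrm{Mem}[\mathcal{DV}]$ and $\mu\in\mathcal D(\mathrm{Mem}[T])$, $T=\mathrm{dom}(\mu)\subseteq\mathcal{RV}$; it is a *program state* if $T=\mathcal{RV}$. *Expressions* are well-typed terms built from variables, constants and arbitrary primitive operations; $[\![e]\!](\sigma,m)$ is the value of $e$, and $[\![e]\!](\sigma,\mu)$ its distribution when $m\sim\mu$. $FV$ denotes free variables. *Programs.* $c ::= \mathbf{skip}\mid x_d\leftarrow e_d\mid x_r\leftarrow e\mid x_r\xleftarrow{\$}\mathrm{Unif}\,T\mid c;c\mid \mathbf{if}\ b\ \mathbf{then}\ c\ \mathbf{else}\ c\mid\mathbf{while}\ b\ \mathbf{do}\ c$, where $x_d\in\mathcal{DV}$,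 $x_r\in\mathcal{RV}$, $e_d$ mentions only deterministic variables, $T$ is a non-empty finite multiset and $b$ is boolean. It is assumed that a command branching on an expression with randomized variables assigns no deterministic variable in its branches or body, and that all loops terminate in finitely many steps on all inputs: from each pair of memories $(\sigma,m)$ some finite number of iterations makes the guard false on all outcomes. $[\![c]\!]$ maps program states to program states. $\mathbf{skip}$, assignment, sampling and sequencing are as usual. For a conditional, if $[\![b]\!](\sigma,\mu)$ is the point mass at $tt$ (resp. $ff$), then the first (resp. second) branch is run; otherwise the result is $(\sigma,\rho\mu_1+(1-\rho)\mu_2)$, where $\rho=\mu(b=tt)$ and $\mu_1,\mu_2$ are the results of the two branches on $(\sigma,\mu\mid b=tt)$ and $(\sigma,\mu\mid b=ff)$. A loop denotes the pointwise limit over $n$ of the sub-distributions given by $(\mathbf{if}\ b\ \mathbf{then}\ c)^n;\mathbf{if}\ b\ \mathbf{then}\ \mathbf{abort}$, where $\mathbf{abort}$ yields the zero sub-distribution. $MV(c)$ is the set of variables assigned or sampled in $c$. The sets $RV(c)$ (may be read before being written) and $WV(c)$ (must be written, before any read) are: $\emptyset,\emptyset$ for $\mathbf{skip}$; $FV(e),\{x\}\setminus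 FV(e)$ for $x\leftarrow e$; $\emptyset,\{x\}$ for sampling; $RV(c)\cup(RV(c')\setminus WV(c))$, $WV(c)\cup(WV(c')\setminus RV(c))$ for $c;c'$; $FV(b)\cup RV(c)\cup RV(c')$, $(WV(c)\cap WV(c'))\setminus FV(b)$ for conditionals; $FV(b)\cup RV(c),\emptyset$ for loops. *Order and combinations.* $(\sigma,\mu)\sqsubseteq(\sigma',\mu')$ iff $\sigma=\sigma'$, $\mathrm{dom}(\mu)\subseteq\mathrm{dom}(\mu')$ and $\pi_{\mathrm{dom}(\mu)}\mu'=\mu$. For a finite family $\mathcal S$ of pairwise disjoint subsets of $\mathrm{dom}(\mu)$, $\mu$ is *$\mathcal S$-PNA* if for every partition $\mathcal T$ of $\bigcup\mathcal S$ into unions of blocks of $\mathcal S$, and all families $f_A:\mathrm{Mem}[A]\to[0,\infty)$ $(A\in\mathcal T)$ that are all monotone or all antitone, $\mathbb E_\mu\prod_{A}f_A\le\prod_{A}\mathbb E_\mu f_A$ (expectations in $[0,\infty]$). For $\mu_1,\mu_2$ with disjoint domains $S_1,S_2$: $\mu_1\otimes\mu_2$ consists of the product distribution on $\mathrm{Mem}[S_1\cup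 S_2]$; $\mu_1\oplus\mu_2$ consists of all $\mu\in\mathcal D(\mathrm{Mem}[S_1\cup S_2])$ with marginals $\mu_1,\mu_2$ such that $\mu$ is $(\mathcal S\cup\mathcal T)$-PNA whenever $\mu_1$ is $\mathcal S$-PNA and $\mu_2$ is $\mathcal T$-PNA. Both are empty if the domains meet. On configurations they are used with equal deterministic memories, and are empty otherwise. *Assertions.* Atoms: $e\sim\mathrm{Unif}\,T$, $e\sim\mathrm{Bern}(p)$, $\mathrm{Detm}(e)$ ($[\![e]\!](\sigma,\mu)$ is respectively uniform on the multiset $T$, Bernoulli, a point mass); $e=e'$, $e\le e'$, $ev=b$ for events (boolean expressions) $ev$ and $b\in\{0,1\}$ (true for all $m$ in the support of $\mu$); $\Pr[ev]\bowtie\delta$ with ${\bowtie}\in\{=,\le,\ge\}$, $\delta\in\mathbb R$. An atom holds only if all its randomized variables are in $\mathrm{dom}(\mu)$. Assertions are $P,Q::=\text{atom}\mid\top\mid\bot\mid P\wedge Q\mid P\vee Q\mid P\to Q\mid P*Q\mid P\mathrel{-\!*}Q\mid P\circledast Q$. $\wedge,\vee$ are pointwise; $x\models P\to Q$ iff for all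 $y\sqsupseteq x$, $y\models P$ implies $y\models Q$; $x\models P*Q$ (resp. $P\circledast Q$) iff there are $x'\sqsubseteq x$ and $y,z$ with $x'\in y\otimes z$ (resp. $y\oplus z$), $y\models P$, $z\models Q$; $x\models P\mathrel{-\!*}Q$ iff $z\in x\otimes y$ and $y\models P$ imply $z\models Q$. $\langle V\rangle$ says that the variables in $V$ are defined (conjunction of $v=v$, $v\in V$). $\models P$ means that all configurations satisfy $P$, and $\models_{\mathrm{Mem}}P$ that all $(\sigma,\delta_m)$ do, with $m\in\mathrm{Mem}[T]$, $T\subseteq\mathcal{RV}$. $P$ is CC if $(\sigma,\mu)\models P$ implies $(\sigma,\delta_m)\models P$ for all $m$ in the support of $\mu$; $P$ is CM if $(\sigma,\mu_i)\models P$ for all $i$ in a countable set implies $(\sigma,\sum_i\nu_i\mu_i)\models P$, for all weights $\nu_i>0$ with $\sum_i\nu_i=1$ and all $\mu_i$ with a common domain. *Proof system.* $\vdash\{\phi\}c\{\psi\}$ is the least relation closed under: - DAssn: $\vdash\{\psi[e_d/x_d]\}\,x_d\leftarrow e_d\,\{\psi\}$. Skip: $\vdash\{\phi\}\mathbf{skip}\{\phi\}$.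 True: $\vdash\{\top\}c\{\top\}$. - Seqn: from $\{\phi\}c\{\psi\}$ and $\{\psi\}c'\{\eta\}$ infer $\{\phi\}c;c'\{\eta\}$. - Cond: from $\{\phi\wedge b=tt\}c\{\psi\}$, $\{\phi\wedge b=ff\}c'\{\psi\}$ and $\models\phi\to\mathrm{Detm}(b)$ infer $\{\phi\}\,\mathbf{if}\ b\ \mathbf{then}\ c\ \mathbf{else}\ c'\,\{\psi\}$. - Loop: from $\{\phi\wedge b=tt\}c\{\phi\}$ and $\models\phi\to\mathrm{Detm}(b)$ infer $\{\phi\}\,\mathbf{while}\ b\ \mathbf{do}\ c\,\{\phi\wedge b=ff\}$. - RAssn: $\{\top\}x_r\leftarrow e\{x_r=e\}$ if $x_r\notin FV(e)$. - RSamp: $\{\top\}x_r\xleftarrow{\$}\mathrm{Unif}\,T\{x_r\sim\mathrm{Unif}\,T\}$. RSamp*: $\{\phi\}x_r\xleftarrow{\$}\mathrm{Unif}\,T\{\phi*x_r\sim\mathrm{Unif}\,T\}$ if $x_r\notin FV(\phi)$. - Weak: from $\{\phi\}c\{\psi\}$ and $\models(\phi'\to\phi)\wedge(\psi\to\psi')$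 infer $\{\phi'\}c\{\psi'\}$. - Conj, Case: from $\{\phi_1\}c\{\psi_1\}$ and $\{\phi_2\}c\{\psi_2\}$ infer $\{\phi_1\wedge\phi_2\}c\{\psi_1\wedge\psi_2\}$, resp. $\{\phi_1\vee\phi_2\}c\{\psi_1\vee\psi_2\}$. - Const: from $\{\phi\}c\{\psi\}$ and $FV(\eta)\cap MV(c)=\emptyset$ infer $\{\phi\wedge\eta\}c\{\psi\wedge\eta\}$. - Frame: from $\{\phi\}c\{\psi\}$, $FV(\eta)\cap MV(c)=\emptyset$, $FV(\psi)\subseteq T\cup RV(c)\cup WV(c)$ and $\models\phi\to\langle T\cup RV(c)\rangle$, for a finite set $T$ of variables, infer $\{\phi*\eta\}c\{\psi*\eta\}$. - RCase: for a finite family $(\eta_\alpha)_{\alpha\in S}$, from $\eta\in$ CC, $\models_{\mathrm{Mem}}\eta\to\bigvee_{\alpha\in S}\eta_\alpha$, $\psi\in$ CM and $\{\phi*\eta_\alpha\}c\{\psi\}$ for all $\alpha\in S$ infer $\{\phi*\eta\}c\{\psi\}$. - NegFrame: for $f(X)$ an expression in the variables $X$ denoting a monotone function, from $\models\phi\to\langle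 RV(c)\rangle$, $FV(\eta)\cap MV(c)=\emptyset$, $X\subseteq RV(c)\setminus MV(c)$, a variable $y\notin FV(\eta)$ and $\{\phi\}c\{y=f(X)\}$ infer $\{\phi\circledast\eta\}c\{\langle y\rangle\circledast\eta\}$. - ProbBound: for $\delta\ge0$, from $\{ev_1=1\}c\{\Pr[ev_2]\le\delta\}$ infer $\{\Pr[ev_1]\ge1-\epsilon\}c\{\Pr[ev_2]\le\delta+\epsilon\}$. **Theorem.** If $\vdash\{\phi\}c\{\psi\}$ is derivable, then it is valid: for every program state $(\sigma,\mu)$ with $(\sigma,\mu)\models\phi$, we have $[\![c]\!](\sigma,\mu)\models\psi$. -/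

import Mathlib

open scoped ENNReal NNReal

noncomputable section

namespace Lina

/-! ### Variables, memories, expressions

`dv` and `rv` are the deterministic and the randomized program variables.  Programs are well-typed:
every variable carries a type of values (`D x`, resp. `R x`), which is preordered. -/

/-- Deterministic memories, on all deterministic variables. -/
abbrev DMem {dv : Type} (D : dv → Type) : Type := (x : dv) → D x

/-- Memories on the set `S` of randomized variables. -/
abbrev RMem {rv : Type} (R : rv → Type) (S : Set rv) : Type := (x : S) → R x

/-- Restriction of a memory to a smaller set of variables. -/
def RMem.restrict {rv : Type} {R : rv → Type} {S T : Set rv} (h : S ⊆ T) (m : RMem R T) :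
    RMem R S :=
  fun x => m ⟨x.1, h x.2⟩

/-- The type of values of a variable, deterministic or randomized. -/
abbrev VarTy {dv rv : Type} (D : dv → Type) (R : rv → Type) : dv ⊕ rv → Type
  | .inl x => D x
  | .inr x => R x

instance VarTy.instPreorder {dv rv : Type} (D : dv → Type) (R : rv → Type)
    [∀ x, Preorder (D x)] [∀ x, Preorder (R x)] : (y : dv ⊕ rv) → Preorder (VarTy D R y)
  | .inl x => inferInstanceAs (Preorder (D x))
  | .inr x => inferInstanceAs (Preorder (R x))

/-- Well-typed expressions: variables, constants, and (curried) applications.  A primitive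
operation is a constant of function type, so the language has all primitive operations. -/
inductive Expr {dv rv : Type} (D : dv → Type) (R : rv → Type) : Type → Type 1
  | dvar (x : dv) : Expr D R (D x)
  | rvar (x : rv) : Expr D R (R x)
  | lit {α : Type} (a : α) : Expr D R α
  | app {α β : Type} (f : Expr D R (α → β)) (e : Expr D R α) : Expr D R β

namespace Expr

variable {dv rv : Type} {D : dv → Type} {R : rv → Type}

/-- The expression consisting of one variable. -/
def var : (y : dv ⊕ rv) → Expr D R (VarTy D R y)
  | .inl x => dvar x
  | .inr x => rvar x

/-- `e + f`. -/
def add {α : Type} [Add α] (e f : Expr D R α) : Expr D R α :=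
  app (app (lit (fun a b : α => a + b)) e) f

/-- `e ∧ f`. -/
def and (e f : Expr D R Bool) : Expr D R Bool := app (app (lit (fun a b => a && b)) e) f

/-- `[e₁, …, eₙ]`. -/
def list {α : Type} : List (Expr D R α) → Expr D R (List α)
  | [] => lit []
  | e :: es => app (app (lit List.cons) e) (list es)

open Classical in
/-- Free variables. -/
def fv {α : Type} : Expr D R α → Finset (dv ⊕ rv)
  | dvar x => {Sum.inl x}
  | rvar x => {Sum.inr x}
  | lit _ => ∅
  | app f e => f.fv ∪ e.fv

/-- All randomized variables of `e` lie in `T`. -/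
def DefinedOn {α : Type} (e : Expr D R α) (T : Set rv) : Prop := ∀ x, Sum.inr x ∈ e.fv → x ∈ T

theorem definedOn_univ {α : Type} (e : Expr D R α) : e.DefinedOn Set.univ := fun _ _ => trivial

theorem DefinedOn.left {α β : Type} {f : Expr D R (α → β)} {e : Expr D R α} {T : Set rv}
    (h : (app f e).DefinedOn T) : f.DefinedOn T :=
  fun x hx => h x (by simp [fv, hx])

theorem DefinedOn.right {α β : Type} {f : Expr D R (α → β)} {e : Expr D R α} {T : Set rv}
    (h : (app f e).DefinedOn T) : e.DefinedOn T :=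
  fun x hx => h x (by simp [fv, hx])

/-- `e` mentions only deterministic variables. -/
def IsDet {α : Type} (e : Expr D R α) : Prop := e.DefinedOn ∅

/-- The value of `e` on a pair of memories `(σ, m)`, where `m` is defined on all randomized
variables of `e`. -/
def eval {α : Type} {T : Set rv} :
    (e : Expr D R α) → DMem D → RMem R T → e.DefinedOn T → α
  | dvar x, σ, _, _ => σ x
  | rvar x, _, m, h => m ⟨x, h x (by simp [fv])⟩
  | lit a, _, _, _ => a
  | app f e, σ, m, h => (f.eval σ m h.left) (e.eval σ m h.right)

/-- The value of a deterministic expression. -/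
def evalDet {α : Type} (e : Expr D R α) (h : e.IsDet) (σ : DMem D) : α :=
  e.eval σ (T := ∅) (fun x => x.2.elim) h

/-- The distribution of the value of `e` in `(σ, μ)`. -/
def dist {α : Type} {T : Set rv} (e : Expr D R α) (σ : DMem D) (μ : PMF (RMem R T))
    (h : e.DefinedOn T) : PMF α :=
  μ.map (fun m => e.eval σ m h)

open Classical in
/-- Substitution of the expression `d` for the deterministic variable `x`. -/
def subst {α : Type} : Expr D R α → (x : dv) → Expr D R (D x) → Expr D R α
  | dvar y, x, d => if h : x = y then h ▸ d else dvar y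
  | rvar y, _, _ => rvar y
  | lit a, _, _ => lit a
  | app f e, x, d => app (f.subst x d) (e.subst x d)

/-- `e` denotes a monotone (non-decreasing) function of its variables. -/
def IsMonotone {α : Type} [Preorder α] [∀ x, Preorder (D x)] [∀ x, Preorder (R x)]
    (e : Expr D R α) : Prop :=
  ∀ (T : Set rv) (h : e.DefinedOn T) (σ σ' : DMem D) (m m' : RMem R T),
    σ ≤ σ' → m ≤ m' → e.eval σ m h ≤ e.eval σ' m' h

end Expr

/-! ### Probabilistic memories, independence, partition negative association -/

/-- A probabilistic memory: a countably supported distribution over the memories on a set `dom`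
of randomized variables. -/
structure PMem {rv : Type} (R : rv → Type) where
  dom : Set rv
  μ : PMF (RMem R dom)

namespace PMem

variable {rv : Type} {R : rv → Type}

/-- The projection of `p` to the variables in `S`. -/
def proj (p : PMem R) (S : Set rv) (h : S ⊆ p.dom) : PMF (RMem R S) :=
  p.μ.map (RMem.restrict h)

/-- `p ⊑ q`: `p` is a projection of `q`. -/
def Le (p q : PMem R) : Prop := ∃ h : p.dom ⊆ q.dom, q.proj p.dom h = p.μ

/-- The independent product of `p` and `q` (at most one element). -/
def indepProd (p q : PMem R) : Set (PMem R) :=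
  {r | Disjoint p.dom q.dom ∧ r.dom = p.dom ∪ q.dom ∧
    ∃ (hp : p.dom ⊆ r.dom) (hq : q.dom ⊆ r.dom),
      ∀ m : RMem R r.dom, r.μ m = p.μ (RMem.restrict hp m) * q.μ (RMem.restrict hq m)}

/-- The blocks are pairwise disjoint: `𝒮` is a (finite) partition of the union of its blocks.
An empty block is harmless. -/
def IsPartition (𝒮 : Finset (Set rv)) : Prop := (𝒮 : Set (Set rv)).PairwiseDisjoint id

/-- The partition `𝒯` coarsens `𝒮`. -/
def Coarsens (𝒯 𝒮 : Finset (Set rv)) : Prop :=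
  IsPartition 𝒯 ∧ ⋃₀ (𝒯 : Set (Set rv)) = ⋃₀ (𝒮 : Set (Set rv)) ∧
    ∀ t ∈ 𝒯, ∃ ℛ : Finset (Set rv), ℛ ⊆ 𝒮 ∧ t = ⋃₀ (ℛ : Set (Set rv))

/-- `p` is `𝒮`-PNA (partition negative association), where `𝒮` partitions a set of variables
of `p`.  Expectations of non-negative functions are taken in `[0, ∞]`. -/
def IsPNA [∀ x, Preorder (R x)] (p : PMem R) (𝒮 : Finset (Set rv)) : Prop :=
  IsPartition 𝒮 ∧ (∀ A ∈ 𝒮, A ⊆ p.dom) ∧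
    ∀ (𝒯 : Finset (Set rv)), Coarsens 𝒯 𝒮 → ∀ (hT : ∀ A ∈ 𝒯, A ⊆ p.dom)
      (f : (A : 𝒯) → RMem R A.1 → ℝ≥0), (∀ A, Monotone (f A)) ∨ (∀ A, Antitone (f A)) →
        ∑' m, p.μ m * ∏ A : 𝒯, (f A (RMem.restrict (hT A.1 A.2) m) : ℝ≥0∞) ≤
          ∏ A : 𝒯, ∑' m, p.μ m * (f A (RMem.restrict (hT A.1 A.2) m) : ℝ≥0∞)

open Classical in
/-- The negative association combination of `p` and `q` (many elements in general). -/
def negProd [∀ x, Preorder (R x)] (p q : PMem R) : Set (PMem R) :=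
  {r | Disjoint p.dom q.dom ∧ r.dom = p.dom ∪ q.dom ∧ p.Le r ∧ q.Le r ∧
    ∀ 𝒮 𝒯 : Finset (Set rv), p.IsPNA 𝒮 → q.IsPNA 𝒯 → r.IsPNA (𝒮 ∪ 𝒯)}

end PMem

/-! ### Configurations -/

/-- Configurations `(σ, μ)`, with `μ` a distribution over the memories on some set of randomized
variables. -/
abbrev Config {dv rv : Type} (D : dv → Type) (R : rv → Type) : Type := DMem D × PMem R

namespace Config

variable {dv rv : Type} {D : dv → Type} {R : rv → Type}

/-- The order of configurations: equality on the deterministic component. -/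
def Le (γ γ' : Config D R) : Prop := γ.1 = γ'.1 ∧ γ.2.Le γ'.2

/-- Independent combination. -/
def indepProd (γ γ' : Config D R) : Set (Config D R) :=
  {δ | γ.1 = γ'.1 ∧ δ.1 = γ.1 ∧ δ.2 ∈ γ.2.indepProd γ'.2}

/-- Negative association combination. -/
def negProd [∀ x, Preorder (R x)] (γ γ' : Config D R) : Set (Config D R) :=
  {δ | γ.1 = γ'.1 ∧ δ.1 = γ.1 ∧ δ.2 ∈ γ.2.negProd γ'.2}

end Config

/-! ### Assertions -/

/-- Comparisons `=`, `≤`, `≥` of a probability with a constant. -/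
inductive Cmp
  | eq | le | ge

/-- The meaning of a comparison. -/
def Cmp.holds : Cmp → ℝ → ℝ → Prop
  | .eq, a, b => a = b
  | .le, a, b => a ≤ b
  | .ge, a, b => b ≤ a

/-- Atomic propositions.  Events are boolean expressions, with `true` read as `1`. -/
inductive Atom {dv rv : Type} (D : dv → Type) (R : rv → Type) : Type 1
  | unif {α : Type} (e : Expr D R α) (T : Multiset α) (hT : T ≠ 0)
  | bern (e : Expr D R ℝ) (p : ℝ)
  | detm {α : Type} (e : Expr D R α)
  | eq {α : Type} (e e' : Expr D R α)
  | le {α : Type} [Preorder α] (e e' : Expr D R α)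
  | event (ev : Expr D R Bool) (b : Bool)
  | prob (ev : Expr D R Bool) (r : Cmp) (δ : ℝ)

namespace Atom

variable {dv rv : Type} {D : dv → Type} {R : rv → Type}

open Classical in
/-- Free variables. -/
def fv : Atom D R → Finset (dv ⊕ rv)
  | unif e _ _ => e.fv
  | bern e _ => e.fv
  | detm e => e.fv
  | eq e e' => e.fv ∪ e'.fv
  | le e e' => e.fv ∪ e'.fv
  | event ev _ => ev.fv
  | prob ev _ _ => ev.fv

/-- Substitution for a deterministic variable. -/
def subst (x : dv) (d : Expr D R (D x)) : Atom D R → Atom D R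
  | unif e T hT => unif (e.subst x d) T hT
  | bern e p => bern (e.subst x d) p
  | detm e => detm (e.subst x d)
  | eq e e' => eq (e.subst x d) (e'.subst x d)
  | le e e' => le (e.subst x d) (e'.subst x d)
  | event ev b => event (ev.subst x d) b
  | prob ev r δ => prob (ev.subst x d) r δ

/-- Satisfaction of atomic propositions; all their variables have to be defined. -/
def Sat (γ : Config D R) : Atom D R → Prop
  | unif e T hT => ∃ h : e.DefinedOn γ.2.dom, e.dist γ.1 γ.2.μ h = PMF.ofMultiset T hT
  | bern e p => ∃ h : e.DefinedOn γ.2.dom,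
      (e.dist γ.1 γ.2.μ h 1).toReal = p ∧ (e.dist γ.1 γ.2.μ h 0).toReal = 1 - p
  | detm e => ∃ h : e.DefinedOn γ.2.dom, ∃ v, e.dist γ.1 γ.2.μ h = PMF.pure v
  | eq e e' => ∃ (h : e.DefinedOn γ.2.dom) (h' : e'.DefinedOn γ.2.dom),
      ∀ m ∈ γ.2.μ.support, e.eval γ.1 m h = e'.eval γ.1 m h'
  | le e e' => ∃ (h : e.DefinedOn γ.2.dom) (h' : e'.DefinedOn γ.2.dom),
      ∀ m ∈ γ.2.μ.support, e.eval γ.1 m h ≤ e'.eval γ.1 m h'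
  | event ev b => ∃ h : ev.DefinedOn γ.2.dom, ∀ m ∈ γ.2.μ.support, ev.eval γ.1 m h = b
  | prob ev r δ => ∃ h : ev.DefinedOn γ.2.dom, r.holds (ev.dist γ.1 γ.2.μ h true).toReal δ

end Atom

/-- Assertions.  `star` and `wand` are the separating conjunction and implication of independence,
`nstar` is the separating conjunction of negative association. -/
inductive Assertion {dv rv : Type} (D : dv → Type) (R : rv → Type) : Type 1
  | atom (a : Atom D R)
  | top
  | bot
  | and (P Q : Assertion D R)
  | or (P Q : Assertion D R)
  | imp (P Q : Assertion D R)
  | star (P Q : Assertion D R)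
  | wand (P Q : Assertion D R)
  | nstar (P Q : Assertion D R)

namespace Assertion

variable {dv rv : Type} {D : dv → Type} {R : rv → Type}

open Classical in
/-- Free variables. -/
def fv : Assertion D R → Finset (dv ⊕ rv)
  | atom a => a.fv
  | top => ∅
  | bot => ∅
  | and P Q => P.fv ∪ Q.fv
  | or P Q => P.fv ∪ Q.fv
  | imp P Q => P.fv ∪ Q.fv
  | star P Q => P.fv ∪ Q.fv
  | wand P Q => P.fv ∪ Q.fv
  | nstar P Q => P.fv ∪ Q.fv

/-- Substitution for a deterministic variable. -/
def subst (x : dv) (d : Expr D R (D x)) : Assertion D R → Assertion D R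
  | atom a => atom (a.subst x d)
  | top => top
  | bot => bot
  | and P Q => and (P.subst x d) (Q.subst x d)
  | or P Q => or (P.subst x d) (Q.subst x d)
  | imp P Q => imp (P.subst x d) (Q.subst x d)
  | star P Q => star (P.subst x d) (Q.subst x d)
  | wand P Q => wand (P.subst x d) (Q.subst x d)
  | nstar P Q => nstar (P.subst x d) (Q.subst x d)

/-- Satisfaction. -/
def Sat [∀ x, Preorder (R x)] : Assertion D R → Config D R → Prop
  | atom a, γ => a.Sat γ
  | top, _ => True
  | bot, _ => False
  | and P Q, γ => P.Sat γ ∧ Q.Sat γ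
  | or P Q, γ => P.Sat γ ∨ Q.Sat γ
  | imp P Q, γ => ∀ γ', γ.Le γ' → P.Sat γ' → Q.Sat γ'
  | star P Q, γ => ∃ γ' γ₁ γ₂ : Config D R, γ'.Le γ ∧ γ' ∈ γ₁.indepProd γ₂ ∧ P.Sat γ₁ ∧ Q.Sat γ₂
  | wand P Q, γ => ∀ γ₁ γ₂ : Config D R, γ₂ ∈ γ.indepProd γ₁ → P.Sat γ₁ → Q.Sat γ₂
  | nstar P Q, γ => ∃ γ' γ₁ γ₂ : Config D R, γ'.Le γ ∧ γ' ∈ γ₁.negProd γ₂ ∧ P.Sat γ₁ ∧ Q.Sat γ₂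

/-- `⊨ P`: all configurations satisfy `P`. -/
def Valid [∀ x, Preorder (R x)] (P : Assertion D R) : Prop := ∀ γ, P.Sat γ

/-- Validity on effectively deterministic configurations. -/
def ValidMem [∀ x, Preorder (R x)] (P : Assertion D R) : Prop :=
  ∀ (σ : DMem D) (T : Set rv) (m : RMem R T), P.Sat (σ, ⟨T, PMF.pure m⟩)

/-- `e = e'`. -/
def eq {α : Type} (e e' : Expr D R α) : Assertion D R := atom (.eq e e')

/-- `⟨e⟩`: all variables of `e` are defined. -/
def isIn {α : Type} (e : Expr D R α) : Assertion D R := eq e e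

/-- `⟨V⟩` for a finite set `V` of variables. -/
def inVars (V : Finset (dv ⊕ rv)) : Assertion D R :=
  V.toList.foldr (fun y P => and (isIn (Expr.var y)) P) top

/-- Finite disjunctions. -/
def bigOr (l : List (Assertion D R)) : Assertion D R := l.foldr or bot

/-- Closed under conditioning. -/
def CC [∀ x, Preorder (R x)] (P : Assertion D R) : Prop :=
  ∀ γ : Config D R, P.Sat γ → ∀ m ∈ γ.2.μ.support, P.Sat (γ.1, ⟨γ.2.dom, PMF.pure m⟩)

/-- Closed under (countable) mixtures: if `(σ, κ i)` satisfies `P` for all `i` of positive weight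
under `ν`, then so does `(σ, ∑ i, ν i • κ i)`. -/
def CM [∀ x, Preorder (R x)] (P : Assertion D R) : Prop :=
  ∀ (σ : DMem D) (T : Set rv) (ν : PMF ℕ) (κ : ℕ → PMF (RMem R T)),
    (∀ i ∈ ν.support, P.Sat (σ, ⟨T, κ i⟩)) → P.Sat (σ, ⟨T, ν.bind κ⟩)

end Assertion

/-! ### Programs -/

/-- Commands.  Only deterministic expressions are assigned to deterministic variables. -/
inductive Com {dv rv : Type} (D : dv → Type) (R : rv → Type) : Type 1
  | skip
  | dassn (x : dv) (e : Expr D R (D x)) (he : e.IsDet)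
  | rassn (x : rv) (e : Expr D R (R x))
  | samp (x : rv) (T : Multiset (R x)) (hT : T ≠ 0)
  | seq (c c' : Com D R)
  | cond (b : Expr D R Bool) (c c' : Com D R)
  | loop (b : Expr D R Bool) (c : Com D R)

/-- Program states: a deterministic memory and a distribution over the memories on all randomized
variables. -/
abbrev State {dv rv : Type} (D : dv → Type) (R : rv → Type) : Type :=
  DMem D × PMF (RMem R Set.univ)

/-- A program state as a configuration. -/
def State.toConfig {dv rv : Type} {D : dv → Type} {R : rv → Type} (s : State D R) : Config D R :=
  (s.1, ⟨Set.univ, s.2⟩)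

/-- The convex combination `ρ • p + (1 - ρ) • q`. -/
def convexComb {α : Type} (ρ : ℝ≥0∞) (hρ : ρ ≤ 1) (p q : PMF α) : PMF α :=
  ⟨fun a => ρ * p a + (1 - ρ) * q a, by
    have h : ∑' a, (ρ * p a + (1 - ρ) * q a) = 1 := by
      rw [ENNReal.tsum_add, ENNReal.tsum_mul_left, ENNReal.tsum_mul_left, p.tsum_coe, q.tsum_coe,
        mul_one, mul_one, add_tsub_cancel_of_le hρ]
    have h' := (ENNReal.summable (f := fun a => ρ * p a + (1 - ρ) * q a)).hasSum
    rwa [h] at h'⟩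

section Semantics

variable {dv rv : Type} {D : dv → Type} {R : rv → Type}

/-- The value of an expression on a full pair of memories. -/
def Expr.evalFull {α : Type} (e : Expr D R α) (σ : DMem D) (m : RMem R Set.univ) : α :=
  e.eval σ m e.definedOn_univ

/-- The distribution of an expression in a program state. -/
def Expr.distFull {α : Type} (e : Expr D R α) (s : State D R) : PMF α :=
  e.dist s.1 s.2 e.definedOn_univ

theorem exists_eval_of_dist_ne {b : Expr D R Bool} {s : State D R} {t : Bool}
    (h : b.distFull s ≠ PMF.pure t) :
    ∃ m ∈ {m | b.evalFull s.1 m = !t}, m ∈ s.2.support := by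
  by_contra hc
  push Not at hc
  apply h
  have h1 : ∀ m ∈ s.2.support, b.evalFull s.1 m = t := by
    intro m hm
    by_contra hne
    exact hc m (by cases t <;> simpa using hne) hm
  have h2 : (b.distFull s).support = {t} := by
    ext v
    simp only [Expr.distFull, Expr.dist, PMF.support_map, Set.mem_image, Set.mem_singleton_iff]
    constructor
    · rintro ⟨m, hm, rfl⟩
      exact h1 m hm
    · rintro rfl
      obtain ⟨m, hm⟩ := s.2.support_nonempty
      exact ⟨m, hm, h1 m hm⟩
  have h3 := (PMF.apply_eq_one_iff (b.distFull s) t).2 h2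
  ext v
  by_cases hv : v = t
  · subst hv
    simp [h3]
  · rw [PMF.pure_apply_of_ne _ _ hv]
    exact (PMF.apply_eq_zero_iff _ _).2 (by rw [h2]; simpa using hv)

open Classical in
/-- The semantics of a conditional, from those of its branches: run a single branch if the guard is
almost surely constant, and otherwise take the convex combination of the results of the branches
on the two conditional distributions. -/
def condSem (b : Expr D R Bool) (f g : State D R → State D R) (s : State D R) : State D R :=
  if ht : b.distFull s = PMF.pure true then f s
  else if hf : b.distFull s = PMF.pure false then g s
  else
    (s.1, convexComb (b.distFull s true) (PMF.coe_le_one _ _)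
      (f (s.1, s.2.filter {m | b.evalFull s.1 m = true} (exists_eval_of_dist_ne hf))).2
      (g (s.1, s.2.filter {m | b.evalFull s.1 m = false} (exists_eval_of_dist_ne ht))).2)

/-- The state after `n` iterations of `if b then f`. -/
def iterSem (b : Expr D R Bool) (f : State D R → State D R) (n : ℕ) (s : State D R) : State D R :=
  (condSem b f id)^[n] s

open Classical in
/-- The weight of `(σ, m)` in a program state. -/
def State.weight (s : State D R) (σ : DMem D) (m : RMem R Set.univ) : ℝ≥0∞ :=
  if s.1 = σ then s.2 m else 0

open Classical in
/-- The weight of `(σ, m)` in the sub-distribution that results from the state `s` by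
`if b then abort`. -/
def abortWeight (b : Expr D R Bool) (s : State D R) (σ : DMem D) (m : RMem R Set.univ) : ℝ≥0∞ :=
  if b.evalFull s.1 m = false then s.weight σ m else 0

/-- `t` is the pointwise limit of the sub-distributions that result from `s` by
`(if b then f)ⁿ; if b then abort`. -/
def IsLoopLimit (b : Expr D R Bool) (f : State D R → State D R) (s t : State D R) : Prop :=
  ∀ σ m, Filter.Tendsto (fun n => abortWeight b (iterSem b f n s) σ m) Filter.atTop
    (nhds (t.weight σ m))

open Classical in
/-- The semantics of a loop: the limit of the truncated unrollings.  It is a full distribution for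
the terminating loops; the value `s` for other loops is arbitrary. -/
def loopSem (b : Expr D R Bool) (f : State D R → State D R) (s : State D R) : State D R :=
  if h : ∃ t, IsLoopLimit b f s t then h.choose else s

open Classical in
/-- The denotational semantics of commands. -/
def Com.sem : Com D R → State D R → State D R
  | .skip, s => s
  | .dassn x e he, s => (Function.update s.1 x (e.evalDet he s.1), s.2)
  | .rassn x e, s =>
      (s.1, s.2.bind fun m => PMF.pure (Function.update m ⟨x, trivial⟩ (e.evalFull s.1 m)))
  | .samp x T hT, s =>
      (s.1, s.2.bind fun m => (PMF.ofMultiset T hT).bind fun v =>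
        PMF.pure (Function.update m ⟨x, trivial⟩ v))
  | .seq c c', s => c'.sem (c.sem s)
  | .cond b c c', s => condSem b c.sem c'.sem s
  | .loop b c, s => loopSem b c.sem s

open Classical in
/-- The variables that a command may modify. -/
def Com.mv : Com D R → Finset (dv ⊕ rv)
  | .skip => ∅
  | .dassn x _ _ => {.inl x}
  | .rassn x _ => {.inr x}
  | .samp x _ _ => {.inr x}
  | .seq c c' => c.mv ∪ c'.mv
  | .cond _ c c' => c.mv ∪ c'.mv
  | .loop _ c => c.mv

open Classical in
/-- The pair `(RV, WV)`: the variables that a command may read before it has written them, and those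
that it must write, before any read. -/
def Com.rwv : Com D R → Finset (dv ⊕ rv) × Finset (dv ⊕ rv)
  | .skip => (∅, ∅)
  | .dassn x e _ => (e.fv, {.inl x} \ e.fv)
  | .rassn x e => (e.fv, {.inr x} \ e.fv)
  | .samp x _ _ => (∅, {.inr x})
  | .seq c c' => (c.rwv.1 ∪ (c'.rwv.1 \ c.rwv.2), c.rwv.2 ∪ (c'.rwv.2 \ c.rwv.1))
  | .cond b c c' => (b.fv ∪ c.rwv.1 ∪ c'.rwv.1, (c.rwv.2 ∩ c'.rwv.2) \ b.fv)
  | .loop b c => (b.fv ∪ c.rwv.1, ∅)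

/-- The variables that a command may read. -/
def Com.readv (c : Com D R) : Finset (dv ⊕ rv) := c.rwv.1

/-- The variables that a command must write. -/
def Com.writev (c : Com D R) : Finset (dv ⊕ rv) := c.rwv.2

/-- A command that branches on an expression with randomized variables does not assign to
deterministic variables in its branches or its body. -/
def Com.WellFormed : Com D R → Prop
  | .skip => True
  | .dassn _ _ _ => True
  | .rassn _ _ => True
  | .samp _ _ _ => True
  | .seq c c' => c.WellFormed ∧ c'.WellFormed
  | .cond b c c' => c.WellFormed ∧ c'.WellFormed ∧
      (b.IsDet ∨ ∀ x, Sum.inl x ∉ c.mv ∧ Sum.inl x ∉ c'.mv)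
  | .loop b c => c.WellFormed ∧ (b.IsDet ∨ ∀ x, Sum.inl x ∉ c.mv)

/-- All loops in the command terminate in finitely many steps on all inputs: from every pair of
memories, some number of iterations makes the guard false on all outcomes. -/
def Com.Terminates : Com D R → Prop
  | .skip => True
  | .dassn _ _ _ => True
  | .rassn _ _ => True
  | .samp _ _ _ => True
  | .seq c c' => c.Terminates ∧ c'.Terminates
  | .cond _ c c' => c.Terminates ∧ c'.Terminates
  | .loop b c => c.Terminates ∧ ∀ (σ : DMem D) (m : RMem R Set.univ), ∃ n,
      ∀ m' ∈ (iterSem b c.sem n (σ, PMF.pure m)).2.support,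
        b.evalFull (iterSem b c.sem n (σ, PMF.pure m)).1 m' = false

/-- Validity of the judgement `{P} c {Q}`. -/
def ValidJudgement [∀ x, Preorder (R x)] (P : Assertion D R) (c : Com D R) (Q : Assertion D R) :
    Prop :=
  ∀ s : State D R, P.Sat s.toConfig → Q.Sat (c.sem s).toConfig

end Semantics

/-! ### The proof system -/

open Classical in
/-- Derivable judgements `⊢ {φ} c {ψ}` of LINA. -/
inductive Derivable {dv rv : Type} {D : dv → Type} {R : rv → Type}
    [∀ x, Preorder (D x)] [∀ x, Preorder (R x)] :
    Assertion D R → Com D R → Assertion D R → Prop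
  | dassn (x : dv) (e : Expr D R (D x)) (he : e.IsDet) (ψ : Assertion D R) :
      Derivable (ψ.subst x e) (.dassn x e he) ψ
  | skip (φ : Assertion D R) : Derivable φ .skip φ
  | seqn {φ ψ η : Assertion D R} {c c' : Com D R} :
      Derivable φ c ψ → Derivable ψ c' η → Derivable φ (.seq c c') η
  | cond {φ ψ : Assertion D R} {b : Expr D R Bool} {c c' : Com D R} :
      Derivable (φ.and (.eq b (.lit true))) c ψ →
      Derivable (φ.and (.eq b (.lit false))) c' ψ →
      (φ.imp (.atom (.detm b))).Valid →
      Derivable φ (.cond b c c') ψ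
  | loop {φ : Assertion D R} {b : Expr D R Bool} {c : Com D R} :
      Derivable (φ.and (.eq b (.lit true))) c φ →
      (φ.imp (.atom (.detm b))).Valid →
      Derivable φ (.loop b c) (φ.and (.eq b (.lit false)))
  | rassn (x : rv) (e : Expr D R (R x)) :
      Sum.inr x ∉ e.fv →
      Derivable .top (.rassn x e) (.eq (.rvar x) e)
  | rsamp (x : rv) (T : Multiset (R x)) (hT : T ≠ 0) :
      Derivable .top (.samp x T hT) (.atom (.unif (.rvar x) T hT))
  | rsampStar (φ : Assertion D R) (x : rv) (T : Multiset (R x)) (hT : T ≠ 0) :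
      Sum.inr x ∉ φ.fv →
      Derivable φ (.samp x T hT) (φ.star (.atom (.unif (.rvar x) T hT)))
  | weak {φ φ' ψ ψ' : Assertion D R} {c : Com D R} :
      Derivable φ c ψ → ((φ'.imp φ).and (ψ.imp ψ')).Valid → Derivable φ' c ψ'
  | triv (c : Com D R) : Derivable .top c .top
  | conj {φ₁ φ₂ ψ₁ ψ₂ : Assertion D R} {c : Com D R} :
      Derivable φ₁ c ψ₁ → Derivable φ₂ c ψ₂ → Derivable (φ₁.and φ₂) c (ψ₁.and ψ₂)
  | case {φ₁ φ₂ ψ₁ ψ₂ : Assertion D R} {c : Com D R} :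
      Derivable φ₁ c ψ₁ → Derivable φ₂ c ψ₂ → Derivable (φ₁.or φ₂) c (ψ₁.or ψ₂)
  | const {φ ψ η : Assertion D R} {c : Com D R} :
      Derivable φ c ψ → Disjoint η.fv c.mv → Derivable (φ.and η) c (ψ.and η)
  | frame {φ ψ η : Assertion D R} {c : Com D R} (T : Finset (dv ⊕ rv)) :
      Derivable φ c ψ →
      Disjoint η.fv c.mv →
      ψ.fv ⊆ T ∪ c.readv ∪ c.writev →
      (φ.imp (.inVars (T ∪ c.readv))).Valid →
      Derivable (φ.star η) c (ψ.star η)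
  | rcase {φ ψ η : Assertion D R} {c : Com D R} (ηs : List (Assertion D R)) :
      η.CC →
      (η.imp (.bigOr ηs)).ValidMem →
      ψ.CM →
      (∀ ηα ∈ ηs, Derivable (φ.star ηα) c ψ) →
      Derivable (φ.star η) c ψ
  | negFrame {φ η : Assertion D R} {c : Com D R} (X : Finset (dv ⊕ rv)) (y : dv ⊕ rv)
      (f : Expr D R (VarTy D R y)) :
      (φ.imp (.inVars c.readv)).Valid →
      Disjoint η.fv c.mv →
      X ⊆ c.readv \ c.mv →
      y ∉ η.fv →
      f.fv ⊆ X →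
      f.IsMonotone →
      Derivable φ c (.eq (.var y) f) →
      Derivable (φ.nstar η) c (.nstar (.isIn (.var y)) η)
  | probBound {ev₁ ev₂ : Expr D R Bool} {c : Com D R} {δ ε : ℝ} :
      0 ≤ δ →
      Derivable (.atom (.event ev₁ true)) c (.atom (.prob ev₂ .le δ)) →
      Derivable (.atom (.prob ev₁ .ge (1 - ε))) c (.atom (.prob ev₂ .le (δ + ε)))

end Lina

end

open scoped ENNReal NNReal

noncomputable section

namespace Lina

/-! ### Probability mass functions -/

section PMFLemmas

universe u

variable {α β γ δ : Type u}

/-! The proof is an induction on the derivation and rests on two structural facts.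

The first concerns commands (`Com.exists_hasKernel`). Since nothing deterministic is assigned under
a randomized guard and all loops stop, a command acts by `(σ, μ) ↦ (F σ, μ.bind (K σ))`. The kernel
leaves unmodified variables fixed pointwise, and inputs that agree on a set containing the read
variables give outputs that agree on this set and on the written variables. For loops, the number of
iterations depends on the initial memory; dominated convergence identifies the limit of the
truncated unrollings with the kernel that runs each memory until it has stopped.

The second concerns assertions. Satisfaction passes to extensions (`Sat.mono`), and to projections
that lose no free randomized variable (`Sat.of_le`); it sees only the free deterministic variables
(`Sat.det_congr`). Passing to projections is delicate for the two implications, where an extension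
of the projection has to be reconciled with the larger distribution: by a coupling for `imp`, by an
independent product for `wand`.

The rules that combine both facts go as follows. For Frame and starred sampling, the output on the
variables of the command is a kernel applied to one independent part, while the other part is not
touched (`ReadsWrites.indepIn`). For RCase, conditioning on the value of the independent part `η`
preserves the law of the part `φ`, and closure under mixtures reassembles the results. ProbBound is
the law of total probability. For NegFrame, the set `X` is by itself one negatively associated
block, so it is negatively associated with the blocks of `η`; the output `y` is a monotone function
of the unmodified `X`, and negative association survives composition with monotone functions of a
block (`IsPNA.of_monotone_value`). In the Loop rule the invariant makes the guard almost surely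
constant at each stage, so the whole distribution leaves the loop at a common step. -/

theorem PMF.bind_congr_support {μ : PMF α} {f g : α → PMF β} (h : ∀ a ∈ μ.support, f a = g a) :
    μ.bind f = μ.bind g := by
  ext b
  simp only [PMF.bind_apply]
  refine tsum_congr fun a => ?_
  by_cases ha : μ a = 0
  · simp [ha]
  · rw [h a ((PMF.mem_support_iff _ _).2 ha)]

theorem PMF.map_congr_support {μ : PMF α} {f g : α → β} (h : ∀ a ∈ μ.support, f a = g a) :
    μ.map f = μ.map g := by
  unfold PMF.map
  exact PMF.bind_congr_support fun a ha => by simp [h a ha]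

theorem PMF.map_eq_pure_iff {μ : PMF α} {f : α → β} {b : β} :
    μ.map f = PMF.pure b ↔ ∀ a ∈ μ.support, f a = b := by
  constructor
  · intro h a ha
    have : f a ∈ (μ.map f).support := (PMF.mem_support_map_iff _ _ _).2 ⟨a, ha, rfl⟩
    rw [h] at this
    simpa using this
  · intro h
    rw [PMF.map_congr_support (g := Function.const α b) h, PMF.map_const]

theorem PMF.tsum_bind_mul (μ : PMF α) (k : α → PMF β) (g : β → ℝ≥0∞) :
    ∑' b, μ.bind k b * g b = ∑' a, μ a * ∑' b, k a b * g b := by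
  simp only [PMF.bind_apply, ← ENNReal.tsum_mul_right, ← ENNReal.tsum_mul_left]
  rw [ENNReal.tsum_comm]
  simp only [mul_assoc]

theorem PMF.tsum_pure_mul (a : α) (g : α → ℝ≥0∞) : ∑' b, PMF.pure a b * g b = g a := by
  rw [tsum_eq_single a]
  · simp
  · intro b hb
    simp [PMF.pure_apply_of_ne _ _ hb]

theorem PMF.tsum_map_mul (μ : PMF α) (f : α → β) (g : β → ℝ≥0∞) :
    ∑' b, μ.map f b * g b = ∑' a, μ a * g (f a) := by
  unfold PMF.map
  rw [PMF.tsum_bind_mul]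
  simp only [Function.comp, PMF.tsum_pure_mul]

theorem PMF.tsum_congr_support {μ : PMF α} {g g' : α → ℝ≥0∞} (h : ∀ a ∈ μ.support, g a = g' a) :
    ∑' a, μ a * g a = ∑' a, μ a * g' a := by
  refine tsum_congr fun a => ?_
  by_cases ha : μ a = 0
  · simp [ha]
  · rw [h a ((PMF.mem_support_iff _ _).2 ha)]

theorem PMF.tsum_mul_const (μ : PMF α) (c : ℝ≥0∞) : ∑' a, μ a * c = c := by
  rw [ENNReal.tsum_mul_right, μ.tsum_coe, one_mul]

theorem PMF.map_apply_of_injective (μ : PMF α) {f : α → β} (hf : Function.Injective f) (a : α) :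
    μ.map f (f a) = μ a := by
  classical
  rw [PMF.map_apply, tsum_eq_single a]
  · simp
  · intro b hb
    rw [if_neg fun h => hb (hf h).symm]

/-- Bind only depends on the image under a map through which the kernels factor. -/
theorem PMF.bind_eq_bind_of_map_eq {μ ν : PMF α} {r : α → β} (h : μ.map r = ν.map r)
    {g g' : α → PMF γ} (hg : ∀ a b, r a = r b → g a = g' b) : μ.bind g = ν.bind g' := by
  -- `g a₀` only serves as a default for the extended kernel off the range of `r`.
  obtain ⟨a₀, -⟩ := μ.support_nonempty
  have h1 : g.FactorsThrough r := fun a b hab => (hg a b hab).trans (hg b b rfl).symm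
  have h2 : ∀ a, Function.extend r g (fun _ => g a₀) (r a) = g a := fun a => h1.extend_apply _ a
  have e1 : μ.bind g = (μ.map r).bind (Function.extend r g (fun _ => g a₀)) := by
    rw [PMF.bind_map]
    congr 1
    funext a
    exact (h2 a).symm
  have e2 : ν.bind g' = (ν.map r).bind (Function.extend r g (fun _ => g a₀)) := by
    rw [PMF.bind_map]
    congr 1
    funext a
    exact ((h2 a).trans (hg a a rfl)).symm
  rw [e1, e2, h]

/-! ### Products, conditional distributions and couplings. -/

/-- The product distribution. -/
def prodPMF (μ : PMF α) (ν : PMF β) : PMF (α × β) := μ.bind fun a => ν.map (Prod.mk a)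

theorem prodPMF_apply (μ : PMF α) (ν : PMF β) (a : α) (b : β) :
    prodPMF μ ν (a, b) = μ a * ν b := by
  classical
  unfold prodPMF
  rw [PMF.bind_apply, tsum_eq_single a]
  · rw [PMF.map_apply_of_injective ν (Prod.mk_right_injective a)]
  · intro a' ha'
    rw [PMF.map_apply]
    simp [ha'.symm]

theorem prodPMF_map (μ : PMF α) (ν : PMF β) (f : α → γ) (g : β → δ) :
    (prodPMF μ ν).map (Prod.map f g) = prodPMF (μ.map f) (ν.map g) := by
  simp only [prodPMF, PMF.map_bind, PMF.map_comp, PMF.bind_map]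
  rfl

theorem prodPMF_map_fst (μ : PMF α) (ν : PMF β) : (prodPMF μ ν).map Prod.fst = μ := by
  simp only [prodPMF, PMF.map_bind, PMF.map_comp]
  have : (fun a : α => PMF.map (Prod.fst ∘ Prod.mk a) ν) = PMF.pure := by
    funext a
    exact PMF.map_const ν a
  rw [this, PMF.bind_pure]

theorem prodPMF_map_snd (μ : PMF α) (ν : PMF β) : (prodPMF μ ν).map Prod.snd = ν := by
  simp only [prodPMF, PMF.map_bind, PMF.map_comp]
  have : (fun a : α => PMF.map (Prod.snd ∘ Prod.mk a) ν) = fun _ => ν := by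
    funext a
    exact PMF.map_id ν
  rw [this, PMF.bind_const]

theorem mem_support_prodPMF {μ : PMF α} {ν : PMF β} {x : α × β} :
    x ∈ (prodPMF μ ν).support ↔ x.1 ∈ μ.support ∧ x.2 ∈ ν.support := by
  obtain ⟨a, b⟩ := x
  simp [PMF.mem_support_iff, prodPMF_apply]

theorem prodPMF_pure (μ : PMF α) (b : β) : prodPMF μ (PMF.pure b) = μ.map (fun a => (a, b)) := by
  simp only [prodPMF, PMF.pure_map]
  rfl

open Classical in
/-- The conditional distributions of `μ` given the value of `g`. -/
def condDist (μ : PMF α) (g : α → β) (b : β) : PMF α :=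
  -- The default `μ` concerns values `b` of probability zero, which carry no weight in a mixture
  -- over `μ.map g`.
  if h : ∃ a ∈ {a | g a = b}, a ∈ μ.support then μ.filter {a | g a = b} h else μ

theorem mem_support_condDist {μ : PMF α} {g : α → β} {b : β} (hb : b ∈ (μ.map g).support) {a : α} :
    a ∈ (condDist μ g b).support ↔ g a = b ∧ a ∈ μ.support := by
  have h : ∃ a ∈ {a | g a = b}, a ∈ μ.support := by
    obtain ⟨a, ha, rfl⟩ := (PMF.mem_support_map_iff _ _ _).1 hb
    exact ⟨a, rfl, ha⟩
  rw [condDist, dif_pos h, PMF.mem_support_filter_iff]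
  rfl

theorem condDist_eq_filter {μ : PMF α} {g : α → β} {b : β}
    (h : ∃ a ∈ {a | g a = b}, a ∈ μ.support) : condDist μ g b = μ.filter {a | g a = b} h :=
  dif_pos h

/-- Disintegration along `g`: only the value `b = g a` contributes to the weight of `a`, and there
the normalizing constant cancels. -/
theorem map_bind_condDist (μ : PMF α) (g : α → β) : (μ.map g).bind (condDist μ g) = μ := by
  classical
  have hmap : ∀ b, μ.map g b = ∑' a, Set.indicator {a | g a = b} μ a := by
    intro b
    rw [PMF.map_apply]
    refine tsum_congr fun a => ?_
    simp only [Set.indicator, Set.mem_ofPred_eq, eq_comm]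
  ext a
  rw [PMF.bind_apply, tsum_eq_single (g a)]
  · by_cases ha : a ∈ μ.support
    · have hb : g a ∈ (μ.map g).support := (PMF.mem_support_map_iff _ _ _).2 ⟨a, ha, rfl⟩
      rw [condDist_eq_filter ⟨a, rfl, ha⟩, PMF.filter_apply, ← hmap]
      simp only [Set.indicator, Set.mem_ofPred_eq, if_true]
      rw [mul_comm (μ a), ← mul_assoc, ENNReal.mul_inv_cancel
        ((PMF.mem_support_iff _ _).1 hb) (PMF.apply_ne_top _ _), one_mul]
    · have : (μ.map g (g a)) * condDist μ g (g a) a = 0 := by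
        by_cases hb : g a ∈ (μ.map g).support
        · have : a ∉ (condDist μ g (g a)).support := fun h => ha ((mem_support_condDist hb).1 h).2
          rw [(PMF.apply_eq_zero_iff _ _).2 this, mul_zero]
        · rw [(PMF.apply_eq_zero_iff _ _).2 hb, zero_mul]
      rw [this, (PMF.apply_eq_zero_iff _ _).2 ha]
  · intro b hb
    by_cases hb' : b ∈ (μ.map g).support
    · have : a ∉ (condDist μ g b).support := fun h => hb ((mem_support_condDist hb').1 h).1.symm
      rw [(PMF.apply_eq_zero_iff _ _).2 this, mul_zero]
    · rw [(PMF.apply_eq_zero_iff _ _).2 hb', zero_mul]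

/-- Distributions with equal images have a coupling over these images. -/
theorem exists_coupling {μ : PMF α} {ν : PMF β} {f : α → γ} {g : β → γ} (h : μ.map f = ν.map g) :
    ∃ ρ : PMF (α × β), ρ.map Prod.fst = μ ∧ ρ.map Prod.snd = ν ∧
      ∀ x ∈ ρ.support, f x.1 = g x.2 := by
  -- Draw the common value first, then both coordinates independently given this value.
  refine ⟨(μ.map f).bind fun c => prodPMF (condDist μ f c) (condDist ν g c), ?_, ?_, ?_⟩
  · simp only [PMF.map_bind, prodPMF_map_fst]
    exact map_bind_condDist μ f
  · simp only [PMF.map_bind, prodPMF_map_snd]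
    rw [h]
    exact map_bind_condDist ν g
  · intro x hx
    obtain ⟨c, hc, hx⟩ := (PMF.mem_support_bind_iff _ _ _).1 hx
    obtain ⟨h1, h2⟩ := mem_support_prodPMF.1 hx
    rw [((mem_support_condDist hc).1 h1).1, ((mem_support_condDist (h ▸ hc)).1 h2).1]

theorem PMF.bind_bool (ν : PMF Bool) (κ : Bool → PMF α) (a : α) :
    ν.bind κ a = ν true * κ true a + (1 - ν true) * κ false a := by
  have h : ν false = 1 - ν true := by
    have := ν.tsum_coe
    rw [tsum_bool] at this
    rw [← this, ENNReal.add_sub_cancel_right (PMF.apply_ne_top _ _)]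
  rw [PMF.bind_apply, tsum_bool, h, add_comm]

end PMFLemmas

/-! ### Probabilistic memories -/

namespace RMem

variable {rv : Type} {R : rv → Type}

open Classical in
/-- A memory on `U` that extends `a` and, outside the domain of `a`, `b`. -/
def glue {S T U : Set rv} (h : U = S ∪ T) (a : RMem R S) (b : RMem R T) : RMem R U := fun x =>
  if hx : x.1 ∈ S then a ⟨x.1, hx⟩
  else b ⟨x.1, (h.subset x.2).resolve_left hx⟩

theorem restrict_glue_left {S T U : Set rv} (h : U = S ∪ T) (a : RMem R S) (b : RMem R T)
    (hS : S ⊆ U) : restrict hS (glue h a b) = a := by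
  funext x
  simp [restrict, glue]

theorem restrict_glue_right {S T U : Set rv} (h : U = S ∪ T) (a : RMem R S) (b : RMem R T)
    (hT : T ⊆ U) (hab : ∀ x (hS : x ∈ S) (hT : x ∈ T), a ⟨x, hS⟩ = b ⟨x, hT⟩) :
    restrict hT (glue h a b) = b := by
  funext x
  by_cases hx : x.1 ∈ S
  · simpa [restrict, glue, hx] using hab x.1 hx x.2
  · simp [restrict, glue, hx]

theorem ext_of_restrict {S T U : Set rv} (h : U = S ∪ T) (hS : S ⊆ U) (hT : T ⊆ U)
    {m m' : RMem R U} (h1 : restrict hS m = restrict hS m') (h2 : restrict hT m = restrict hT m') :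
    m = m' := by
  funext x
  have hx : x.1 ∈ S ∪ T := h ▸ x.2
  rcases hx with hx | hx
  · exact congrFun h1 ⟨x.1, hx⟩
  · exact congrFun h2 ⟨x.1, hx⟩

end RMem

namespace PMem

variable {rv : Type} {R : rv → Type}

open RMem

theorem Le.refl (p : PMem R) : p.Le p := ⟨subset_rfl, PMF.map_id _⟩

theorem Le.trans {p q r : PMem R} (h : p.Le q) (h' : q.Le r) : p.Le r := by
  obtain ⟨h1, h2⟩ := h
  obtain ⟨h3, h4⟩ := h'
  refine ⟨h1.trans h3, ?_⟩
  rw [← h2, proj, proj, ← h4, proj, PMF.map_comp]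
  rfl

theorem Le.of_le_of_le {p q r : PMem R} (hp : p.Le r) (hq : q.Le r) (h : p.dom ⊆ q.dom) :
    p.Le q := by
  obtain ⟨h1, h2⟩ := hp
  obtain ⟨h3, h4⟩ := hq
  refine ⟨h, ?_⟩
  rw [← h2, proj, proj, ← h4, proj, PMF.map_comp]
  rfl

/-- The restriction of `p` to the variables in `V`. -/
def res (p : PMem R) (V : Set rv) : PMem R := ⟨V ∩ p.dom, p.proj _ Set.inter_subset_right⟩

theorem res_le (p : PMem R) (V : Set rv) : (p.res V).Le p := ⟨Set.inter_subset_right, rfl⟩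

/-- Amalgamation over a common projection: couple `p` and `q` along `s`. Since `s` contains all
shared variables, coupled memories agree on them and can be merged. -/
theorem exists_glue {p q s : PMem R} (hp : s.Le p) (hq : s.Le q) (hs : p.dom ∩ q.dom ⊆ s.dom) :
    ∃ r : PMem R, p.Le r ∧ q.Le r ∧ r.dom = p.dom ∪ q.dom := by
  obtain ⟨hp1, hp2⟩ := hp
  obtain ⟨hq1, hq2⟩ := hq
  obtain ⟨ρ, h1, h2, h3⟩ := exists_coupling (hp2.trans hq2.symm)
  refine ⟨⟨p.dom ∪ q.dom, ρ.map fun x => glue rfl x.1 x.2⟩,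
    ⟨Set.subset_union_left, ?_⟩, ⟨Set.subset_union_right, ?_⟩, rfl⟩
  · rw [proj, PMF.map_comp]
    conv_rhs => rw [← h1]
    congr 1
    funext x
    exact restrict_glue_left _ _ _ _
  · rw [proj, PMF.map_comp]
    conv_rhs => rw [← h2]
    refine PMF.map_congr_support fun x hx => restrict_glue_right _ _ _ _ fun y hS hT => ?_
    exact congrFun (h3 x hx) ⟨y, hs ⟨hS, hT⟩⟩

/-! ### Independence inside a larger distribution. -/

/-- `p` and `q` are projections of `r` to disjoint, independent sets of variables. -/
def IndepIn (p q r : PMem R) : Prop :=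
  Disjoint p.dom q.dom ∧ ∃ (hp : p.dom ⊆ r.dom) (hq : q.dom ⊆ r.dom),
    r.μ.map (fun m => (restrict hp m, restrict hq m)) = prodPMF p.μ q.μ

theorem IndepIn.le_left {p q r : PMem R} (h : p.IndepIn q r) : p.Le r := by
  obtain ⟨-, hp, hq, h⟩ := h
  refine ⟨hp, ?_⟩
  rw [← prodPMF_map_fst p.μ q.μ, ← h, PMF.map_comp]
  rfl

theorem IndepIn.le_right {p q r : PMem R} (h : p.IndepIn q r) : q.Le r := by
  obtain ⟨-, hp, hq, h⟩ := h
  refine ⟨hq, ?_⟩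
  rw [← prodPMF_map_snd p.μ q.μ, ← h, PMF.map_comp]
  rfl

theorem IndepIn.trans {p q r s : PMem R} (h : p.IndepIn q r) (hr : r.Le s) : p.IndepIn q s := by
  obtain ⟨hd, hp, hq, h⟩ := h
  obtain ⟨hr, h'⟩ := hr
  refine ⟨hd, hp.trans hr, hq.trans hr, ?_⟩
  rw [← h, ← h', proj, PMF.map_comp]
  rfl

theorem IndepIn.of_le {p q p' q' r : PMem R} (h : p.IndepIn q r) (hp' : p'.Le p) (hq' : q'.Le q) :
    p'.IndepIn q' r := by
  obtain ⟨hd, hp, hq, h⟩ := h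
  obtain ⟨hp', h1⟩ := hp'
  obtain ⟨hq', h2⟩ := hq'
  refine ⟨hd.mono hp' hq', hp'.trans hp, hq'.trans hq, ?_⟩
  rw [← h1, ← h2, proj, proj, ← prodPMF_map, ← h, PMF.map_comp]
  rfl

theorem IndepIn.le_res {p q r s : PMem R} (h : p.IndepIn q r) (hs : s.Le r)
    (hp : p.dom ⊆ s.dom) (hq : q.dom ⊆ s.dom) : p.IndepIn q s := by
  obtain ⟨hd, hp', hq', h⟩ := h
  obtain ⟨hs, h1⟩ := hs
  refine ⟨hd, hp, hq, ?_⟩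
  rw [← h, ← h1, proj, PMF.map_comp]
  rfl

/-- A memory on the union of the domains is determined by its two restrictions, so the pointwise
product formula amounts to an equality of joint laws. The latter also makes sense when `r` has
further variables. -/
theorem mem_indepProd_iff {p q r : PMem R} :
    r ∈ p.indepProd q ↔ r.dom = p.dom ∪ q.dom ∧ p.IndepIn q r := by
  constructor
  · rintro ⟨hd, hr, hp, hq, h⟩
    refine ⟨hr, hd, hp, hq, ?_⟩
    have hinj : Function.Injective fun m : RMem R r.dom => (restrict hp m, restrict hq m) :=
      fun m m' hm => ext_of_restrict hr hp hq (congrArg Prod.fst hm) (congrArg Prod.snd hm)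
    ext ⟨a, b⟩
    have hab : (a, b) = (restrict hp (glue hr a b), restrict hq (glue hr a b)) := by
      rw [restrict_glue_left, restrict_glue_right]
      exact fun x hS hT => (Set.disjoint_left.1 hd hS hT).elim
    rw [hab, PMF.map_apply_of_injective r.μ hinj, prodPMF_apply]
    exact h _
  · rintro ⟨hr, hd, hp, hq, h⟩
    refine ⟨hd, hr, hp, hq, fun m => ?_⟩
    have hinj : Function.Injective fun m : RMem R r.dom => (restrict hp m, restrict hq m) :=
      fun m m' hm => ext_of_restrict hr hp hq (congrArg Prod.fst hm) (congrArg Prod.snd hm)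
    rw [← prodPMF_apply, ← h, PMF.map_apply_of_injective r.μ hinj]

theorem exists_mem_indepProd {p q : PMem R} (hd : Disjoint p.dom q.dom) :
    ∃ r, r ∈ p.indepProd q := by
  refine ⟨⟨p.dom ∪ q.dom, (prodPMF p.μ q.μ).map fun x => glue rfl x.1 x.2⟩,
    mem_indepProd_iff.2 ⟨rfl, hd, Set.subset_union_left, Set.subset_union_right, ?_⟩⟩
  rw [PMF.map_comp]
  conv_rhs => rw [← PMF.map_id (prodPMF p.μ q.μ)]
  congr 1
  funext x
  simp only [Function.comp, restrict_glue_left, id]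
  rw [restrict_glue_right]
  exact fun x hS hT => (Set.disjoint_left.1 hd hS hT).elim

theorem indepProd_unique {p q r r' : PMem R} (h : r ∈ p.indepProd q) (h' : r' ∈ p.indepProd q) :
    r = r' := by
  obtain ⟨-, h1, h2, h3, h4⟩ := h
  obtain ⟨-, h1', h2', h3', h4'⟩ := h'
  obtain ⟨S, μ⟩ := r
  obtain ⟨T, ν⟩ := r'
  obtain rfl : S = T := h1.trans h1'.symm
  have : μ = ν := PMF.ext fun m => (h4 m).trans (h4' m).symm
  rw [this]

theorem IndepIn.exists_le {p q r : PMem R} (h : p.IndepIn q r) :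
    ∃ s, s.Le r ∧ s ∈ p.indepProd q := by
  have hdom : (r.res (p.dom ∪ q.dom)).dom = p.dom ∪ q.dom :=
    Set.inter_eq_left.2 (Set.union_subset h.2.1 h.2.2.1)
  exact ⟨_, res_le _ _, mem_indepProd_iff.2 ⟨hdom, h.le_res (res_le _ _)
    (hdom.symm ▸ Set.subset_union_left) (hdom.symm ▸ Set.subset_union_right)⟩⟩

/-! ### Partition negative association -/

theorem Coarsens.subset {𝒯 𝒮 : Finset (Set rv)} (h : Coarsens 𝒯 𝒮) {B : Set rv}
    (hB : ∀ A ∈ 𝒮, A ⊆ B) : ∀ A ∈ 𝒯, A ⊆ B := by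
  intro A hA
  refine (Set.subset_sUnion_of_mem (Finset.mem_coe.2 hA)).trans ?_
  rw [h.2.1]
  exact Set.sUnion_subset fun A hA => hB A hA

/-- The inequalities only involve expectations of functions of the variables in the blocks, and
these are the same for a distribution and its projection. -/
theorem isPNA_iff_of_le [∀ x, Preorder (R x)] {p q : PMem R} (h : p.Le q)
    {𝒮 : Finset (Set rv)} (hS : ∀ A ∈ 𝒮, A ⊆ p.dom) : p.IsPNA 𝒮 ↔ q.IsPNA 𝒮 := by
  obtain ⟨h1, h2⟩ := h
  constructor
  · rintro ⟨ha, -, hc⟩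
    refine ⟨ha, fun A hA => (hS A hA).trans h1, fun 𝒯 h𝒯 hT f hf => ?_⟩
    have := hc 𝒯 h𝒯 (h𝒯.subset hS) f hf
    rw [← h2] at this
    simp only [proj, PMF.tsum_map_mul] at this
    exact this
  · rintro ⟨ha, -, hc⟩
    refine ⟨ha, hS, fun 𝒯 h𝒯 hT f hf => ?_⟩
    rw [← h2]
    simp only [proj, PMF.tsum_map_mul]
    exact hc 𝒯 h𝒯 (fun A hA => (hT A hA).trans h1) f hf

open Classical in
/-- `p` and `q` are projections of `r` to disjoint, negatively associated sets of variables. -/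
def NegIn [∀ x, Preorder (R x)] (p q r : PMem R) : Prop :=
  Disjoint p.dom q.dom ∧ p.Le r ∧ q.Le r ∧
    ∀ 𝒮 𝒯 : Finset (Set rv), p.IsPNA 𝒮 → q.IsPNA 𝒯 →
      r.IsPNA (𝒮 ∪ 𝒯)

open Classical in
theorem NegIn.le_res [∀ x, Preorder (R x)] {p q r s : PMem R} (h : p.NegIn q r) (hs : s.Le r)
    (hp : p.dom ⊆ s.dom) (hq : q.dom ⊆ s.dom) : p.NegIn q s := by
  obtain ⟨hd, h1, h2, h3⟩ := h
  refine ⟨hd, h1.of_le_of_le hs hp, h2.of_le_of_le hs hq, fun 𝒮 𝒯 hS hT => ?_⟩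
  refine (isPNA_iff_of_le hs fun A hA => ?_).2 (h3 𝒮 𝒯 hS hT)
  rcases Finset.mem_union.1 hA with hA | hA
  · exact (hS.2.1 A hA).trans hp
  · exact (hT.2.1 A hA).trans hq

open Classical in
theorem NegIn.trans [∀ x, Preorder (R x)] {p q r s : PMem R} (h : p.NegIn q r) (hs : r.Le s) :
    p.NegIn q s := by
  obtain ⟨hd, h1, h2, h3⟩ := h
  refine ⟨hd, h1.trans hs, h2.trans hs, fun 𝒮 𝒯 hS hT => ?_⟩
  exact (isPNA_iff_of_le hs (h3 𝒮 𝒯 hS hT).2.1).1 (h3 𝒮 𝒯 hS hT)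

theorem NegIn.of_le [∀ x, Preorder (R x)] {p q p' q' r : PMem R} (h : p.NegIn q r)
    (hp : p'.Le p) (hq : q'.Le q) : p'.NegIn q' r := by
  obtain ⟨hd, h1, h2, h3⟩ := h
  exact ⟨hd.mono hp.1 hq.1, hp.trans h1, hq.trans h2, fun 𝒮 𝒯 hS hT =>
    h3 𝒮 𝒯 ((isPNA_iff_of_le hp hS.2.1).1 hS) ((isPNA_iff_of_le hq hT.2.1).1 hT)⟩

theorem mem_negProd_iff [∀ x, Preorder (R x)] {p q r : PMem R} :
    r ∈ p.negProd q ↔ r.dom = p.dom ∪ q.dom ∧ p.NegIn q r := by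
  constructor
  · rintro ⟨h1, h2, h3⟩
    exact ⟨h2, h1, h3⟩
  · rintro ⟨h1, h2, h3⟩
    exact ⟨h2, h1, h3⟩

theorem NegIn.exists_le [∀ x, Preorder (R x)] {p q r : PMem R} (h : p.NegIn q r) :
    ∃ s, s.Le r ∧ s ∈ p.negProd q := by
  have hdom : (r.res (p.dom ∪ q.dom)).dom = p.dom ∪ q.dom :=
    Set.inter_eq_left.2 (Set.union_subset h.2.1.1 h.2.2.1.1)
  exact ⟨_, res_le _ _, mem_negProd_iff.2 ⟨hdom, h.le_res (res_le _ _)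
    (hdom.symm ▸ Set.subset_union_left) (hdom.symm ▸ Set.subset_union_right)⟩⟩

end PMem

open scoped Classical

variable {dv rv : Type} {D : dv → Type} {R : rv → Type}

/-! ### Expressions and atoms -/

/-- Atoms are existentials over proofs of definedness; this compares two of them componentwise. -/
theorem exists_prop_iff {a b : Prop} {p : a → Prop} {q : b → Prop} (hab : a ↔ b)
    (h : ∀ ha hb, p ha ↔ q hb) : (∃ h, p h) ↔ ∃ h, q h :=
  ⟨fun ⟨ha, hp⟩ => ⟨hab.1 ha, (h ha _).1 hp⟩, fun ⟨hb, hq⟩ => ⟨hab.2 hb, (h _ hb).2 hq⟩⟩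

theorem Expr.eval_congr {α : Type} (e : Expr D R α) {σ σ' : DMem D} {S T : Set rv}
    {m : RMem R S} {m' : RMem R T} (h : e.DefinedOn S) (h' : e.DefinedOn T)
    (hσ : ∀ x, Sum.inl x ∈ e.fv → σ x = σ' x)
    (hm : ∀ x (hx : Sum.inr x ∈ e.fv), m ⟨x, h x hx⟩ = m' ⟨x, h' x hx⟩) :
    e.eval σ m h = e.eval σ' m' h' := by
  induction e with
  | dvar x => exact hσ x (by simp [Expr.fv])
  | rvar x => exact hm x (by simp [Expr.fv])
  | lit a => rfl
  | app f e ihf ihe =>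
    simp only [Expr.eval]
    rw [ihf h.left h'.left (fun x hx => hσ x (by simp [Expr.fv, hx]))
      (fun x hx => hm x (by simp [Expr.fv, hx])), ihe h.right h'.right
      (fun x hx => hσ x (by simp [Expr.fv, hx])) (fun x hx => hm x (by simp [Expr.fv, hx]))]

theorem Expr.dist_congr {α : Type} (e : Expr D R α) {σ σ' : DMem D} {p q : PMem R} (hle : p.Le q)
    (h : e.DefinedOn p.dom) (h' : e.DefinedOn q.dom)
    (hσ : ∀ x, Sum.inl x ∈ e.fv → σ x = σ' x) :
    e.dist σ p.μ h = e.dist σ' q.μ h' := by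
  obtain ⟨h1, h2⟩ := hle
  rw [Expr.dist, ← h2, PMem.proj, PMF.map_comp]
  refine PMF.map_congr_support fun m _ => ?_
  exact e.eval_congr _ _ hσ fun x hx => rfl

theorem PMem.Le.forall_support {p q : PMem R} (h : p.Le q) {P : RMem R p.dom → Prop} :
    (∀ m ∈ p.μ.support, P m) ↔ ∀ m ∈ q.μ.support, P (RMem.restrict h.1 m) := by
  obtain ⟨h1, h2⟩ := h
  simp only [← h2, PMem.proj, PMF.support_map, Set.forall_mem_image]

theorem Atom.definedOn_of_sat {a : Atom D R} {γ : Config D R} (h : a.Sat γ) :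
    ∀ x, Sum.inr x ∈ a.fv → x ∈ γ.2.dom := by
  cases a with
  | unif e T hT => exact h.1
  | bern e p => exact h.1
  | detm e => exact h.1
  | eq e e' =>
    obtain ⟨h1, h2, -⟩ := h
    exact fun x hx => (Finset.mem_union.1 hx).elim (h1 x) (h2 x)
  | le e e' =>
    obtain ⟨h1, h2, -⟩ := h
    exact fun x hx => (Finset.mem_union.1 hx).elim (h1 x) (h2 x)
  | event e b => exact h.1
  | prob e r δ => exact h.1

/-- By `hdom`, the expressions in `a` are defined on `p` exactly when they are defined on `q`, and
then their values depend only on the marginal `p`. Allowing `σ` and `σ'` to differ covers dependence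
on both kinds of variables at once. -/
theorem Atom.sat_iff {a : Atom D R} {σ σ' : DMem D} {p q : PMem R} (hle : p.Le q)
    (hdom : ∀ x, Sum.inr x ∈ a.fv → x ∈ q.dom → x ∈ p.dom)
    (hσ : ∀ x, Sum.inl x ∈ a.fv → σ x = σ' x) :
    a.Sat (σ, p) ↔ a.Sat (σ', q) := by
  have hdef : ∀ {α : Type} (e : Expr D R α), e.fv ⊆ a.fv →
      (e.DefinedOn p.dom ↔ e.DefinedOn q.dom) := fun e he =>
    ⟨fun h x hx => hle.1 (h x hx), fun h x hx => hdom x (he hx) (h x hx)⟩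
  have hdist : ∀ {α : Type} (e : Expr D R α), e.fv ⊆ a.fv → ∀ (C : PMF α → Prop),
      ((∃ h : e.DefinedOn p.dom, C (e.dist σ p.μ h)) ↔
        ∃ h : e.DefinedOn q.dom, C (e.dist σ' q.μ h)) := by
    intro α e he C
    refine exists_prop_iff (hdef e he) fun h h₁ => ?_
    rw [e.dist_congr hle _ _ fun x hx => hσ x (he hx)]
  have heval : ∀ {α : Type} (e : Expr D R α), e.fv ⊆ a.fv →
      ∀ (h : e.DefinedOn p.dom) (h' : e.DefinedOn q.dom) (m : RMem R q.dom),
        e.eval σ (RMem.restrict hle.1 m) h = e.eval σ' m h' := fun e he h h' m =>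
    e.eval_congr _ _ (fun x hx => hσ x (he hx)) fun x hx => rfl
  cases a with
  | unif e T hT => exact hdist e subset_rfl (fun μ => μ = PMF.ofMultiset T hT)
  | bern e r =>
    exact hdist e subset_rfl (fun μ => (μ 1).toReal = r ∧ (μ 0).toReal = 1 - r)
  | detm e => exact hdist e subset_rfl (fun μ => ∃ v, μ = PMF.pure v)
  | eq e e' =>
    have h1 : e.fv ⊆ (Atom.eq e e').fv := Finset.subset_union_left
    have h2 : e'.fv ⊆ (Atom.eq e e').fv := Finset.subset_union_right
    refine exists_prop_iff (hdef e h1) fun h h₁ => ?_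
    refine exists_prop_iff (hdef e' h2) fun h' h'₁ => ?_
    rw [hle.forall_support]
    simp only [heval e h1 h h₁, heval e' h2 h' h'₁]
  | le e e' =>
    have h1 : e.fv ⊆ (Atom.le e e').fv := Finset.subset_union_left
    have h2 : e'.fv ⊆ (Atom.le e e').fv := Finset.subset_union_right
    refine exists_prop_iff (hdef e h1) fun h h₁ => ?_
    refine exists_prop_iff (hdef e' h2) fun h' h'₁ => ?_
    rw [hle.forall_support]
    simp only [heval e h1 h h₁, heval e' h2 h' h'₁]
  | event e b =>
    refine exists_prop_iff (hdef e subset_rfl) fun h h₁ => ?_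
    rw [hle.forall_support]
    simp only [heval e subset_rfl h h₁]
  | prob e r δ => exact hdist e subset_rfl (fun μ => r.holds (μ true).toReal δ)

/-! ### Satisfaction of assertions -/

namespace Assertion

variable [∀ x, Preorder (R x)]

/-- The intermediate configuration of the semantics is absorbed: independence extends to the ambient
distribution, and conversely restricts to the union of the two domains. -/
theorem sat_star_iff {P Q : Assertion D R} {σ : DMem D} {s : PMem R} :
    (star P Q).Sat (σ, s) ↔ ∃ p q : PMem R, p.IndepIn q s ∧ P.Sat (σ, p) ∧ Q.Sat (σ, q) := by
  constructor
  · rintro ⟨⟨σ', r⟩, ⟨σ₁, p⟩, ⟨σ₂, q⟩, ⟨h1, h2⟩, ⟨h3, h4, h5⟩, h6, h7⟩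
    dsimp only at h1 h2 h3 h4 h5
    subst h1 h4 h3
    exact ⟨p, q, (PMem.mem_indepProd_iff.1 h5).2.trans h2, h6, h7⟩
  · rintro ⟨p, q, h, h1, h2⟩
    obtain ⟨r, hr, hr'⟩ := h.exists_le
    exact ⟨(σ, r), (σ, p), (σ, q), ⟨rfl, hr⟩, ⟨rfl, rfl, hr'⟩, h1, h2⟩

theorem sat_nstar_iff {P Q : Assertion D R} {σ : DMem D} {s : PMem R} :
    (nstar P Q).Sat (σ, s) ↔ ∃ p q : PMem R, p.NegIn q s ∧ P.Sat (σ, p) ∧ Q.Sat (σ, q) := by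
  constructor
  · rintro ⟨⟨σ', r⟩, ⟨σ₁, p⟩, ⟨σ₂, q⟩, ⟨h1, h2⟩, ⟨h3, h4, h5⟩, h6, h7⟩
    dsimp only at h1 h2 h3 h4 h5
    subst h1 h4 h3
    exact ⟨p, q, (PMem.mem_negProd_iff.1 h5).2.trans h2, h6, h7⟩
  · rintro ⟨p, q, h, h1, h2⟩
    obtain ⟨r, hr, hr'⟩ := h.exists_le
    exact ⟨(σ, r), (σ, p), (σ, q), ⟨rfl, hr⟩, ⟨rfl, rfl, hr'⟩, h1, h2⟩

theorem sat_imp_iff {P Q : Assertion D R} {σ : DMem D} {p : PMem R} :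
    (imp P Q).Sat (σ, p) ↔ ∀ q, p.Le q → P.Sat (σ, q) → Q.Sat (σ, q) :=
  ⟨fun h q hq => h (σ, q) ⟨rfl, hq⟩, by rintro h ⟨σ', q⟩ ⟨rfl, hq⟩; exact h q hq⟩

theorem sat_wand_iff {P Q : Assertion D R} {σ : DMem D} {p : PMem R} :
    (wand P Q).Sat (σ, p) ↔ ∀ q r, r ∈ p.indepProd q → P.Sat (σ, q) → Q.Sat (σ, r) := by
  constructor
  · exact fun h q r hr hq => h (σ, q) (σ, r) ⟨rfl, rfl, hr⟩ hq
  · rintro h ⟨σ₁, q⟩ ⟨σ₂, r⟩ ⟨h1, h2, h3⟩ hq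
    dsimp only at h1 h2
    subst h1 h2
    exact h q r h3 hq

/-! ### Monotonicity and locality of satisfaction. -/

/-- Satisfaction is preserved by extensions. -/
theorem Sat.mono {P : Assertion D R} {σ : DMem D} {p q : PMem R} (h : P.Sat (σ, p))
    (hle : p.Le q) : P.Sat (σ, q) := by
  induction P generalizing p q with
  | atom a =>
    exact (Atom.sat_iff hle (fun x hx _ => Atom.definedOn_of_sat h x hx) fun _ _ => rfl).1 h
  | top => trivial
  | bot => exact h
  | and P Q ihP ihQ => exact ⟨ihP h.1 hle, ihQ h.2 hle⟩
  | or P Q ihP ihQ => exact h.imp (fun h => ihP h hle) (fun h => ihQ h hle)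
  | imp P Q ihP ihQ =>
    rw [sat_imp_iff] at h ⊢
    exact fun r hr => h r (hle.trans hr)
  | star P Q ihP ihQ =>
    rw [sat_star_iff] at h ⊢
    obtain ⟨a, b, hab, ha, hb⟩ := h
    exact ⟨a, b, hab.trans hle, ha, hb⟩
  | nstar P Q ihP ihQ =>
    rw [sat_nstar_iff] at h ⊢
    obtain ⟨a, b, hab, ha, hb⟩ := h
    exact ⟨a, b, hab.trans hle, ha, hb⟩
  | wand P Q ihP ihQ =>
    rw [sat_wand_iff] at h ⊢
    intro a r hr ha
    have hr' := (PMem.mem_indepProd_iff.1 hr).2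
    -- The product of `q` with `a` projects to a product of `p` with `a`, where the hypothesis
    -- applies.
    obtain ⟨t, ht, ht'⟩ := (hr'.of_le hle (PMem.Le.refl a)).exists_le
    exact ihQ (h a t ht' ha) ht

/-- Satisfaction depends on the free randomized variables only. -/
theorem Sat.of_le {P : Assertion D R} {σ : DMem D} {p q : PMem R} (h : P.Sat (σ, q))
    (hle : p.Le q) (hdom : ∀ x, Sum.inr x ∈ P.fv → x ∈ q.dom → x ∈ p.dom) : P.Sat (σ, p) := by
  induction P generalizing p q with
  | atom a => exact (Atom.sat_iff hle hdom fun _ _ => rfl).2 h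
  | top => trivial
  | bot => exact h
  | and P Q ihP ihQ =>
    exact ⟨ihP h.1 hle fun x hx => hdom x (Finset.mem_union_left _ hx),
      ihQ h.2 hle fun x hx => hdom x (Finset.mem_union_right _ hx)⟩
  | or P Q ihP ihQ =>
    exact h.imp (fun h => ihP h hle fun x hx => hdom x (Finset.mem_union_left _ hx))
      (fun h => ihQ h hle fun x hx => hdom x (Finset.mem_union_right _ hx))
  | imp P Q ihP ihQ =>
    rw [sat_imp_iff] at h ⊢
    intro t hpt ht
    -- The extension `t` of `p` may clash with `q` on irrelevant variables, so it is first cut down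
    -- to the free ones.
    set V : Set rv := {x | Sum.inr x ∈ (imp P Q).fv} with hV
    have hP : ∀ x, Sum.inr x ∈ P.fv → x ∈ V := fun x hx => Finset.mem_union_left _ hx
    have hQ : ∀ x, Sum.inr x ∈ Q.fv → x ∈ V := fun x hx => Finset.mem_union_right _ hx
    have ht' : P.Sat (σ, t.res V) := ihP ht (t.res_le V) fun x hx hxt => ⟨hP x hx, hxt⟩
    have hst : (p.res V).Le (t.res V) :=
      ((p.res_le V).trans hpt).of_le_of_le (t.res_le V) (Set.inter_subset_inter_right _ hpt.1)
    -- Free variables in `q.dom` lie in `p.dom`, so `t.res V` and `q` overlap only inside `p.res V`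
    -- and have a common extension `r`. There `Q` holds, and it descends to `t.res V`.
    obtain ⟨r, h1, h2, h3⟩ := PMem.exists_glue hst ((p.res_le V).trans hle)
      fun x hx => ⟨hx.1.1, hdom x hx.1.1 hx.2⟩
    refine (ihQ (h r h2 (ht'.mono h1)) h1 fun x hx hxr => ?_).mono (t.res_le V)
    rw [h3] at hxr
    rcases hxr with hxr | hxr
    · exact hxr
    · exact ⟨hQ x hx, hpt.1 (hdom x (hQ x hx) hxr)⟩
  | star P Q ihP ihQ =>
    rw [sat_star_iff] at h ⊢
    obtain ⟨a, b, hab, ha, hb⟩ := h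
    refine ⟨a.res p.dom, b.res p.dom, (hab.of_le (a.res_le _) (b.res_le _)).le_res hle
      Set.inter_subset_left Set.inter_subset_left, ihP ha (a.res_le _) fun x hx hxa => ⟨?_, hxa⟩,
      ihQ hb (b.res_le _) fun x hx hxb => ⟨?_, hxb⟩⟩
    · exact hdom x (Finset.mem_union_left _ hx) (hab.le_left.1 hxa)
    · exact hdom x (Finset.mem_union_right _ hx) (hab.le_right.1 hxb)
  | nstar P Q ihP ihQ =>
    rw [sat_nstar_iff] at h ⊢
    obtain ⟨a, b, hab, ha, hb⟩ := h
    refine ⟨a.res p.dom, b.res p.dom, (hab.of_le (a.res_le _) (b.res_le _)).le_res hle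
      Set.inter_subset_left Set.inter_subset_left, ihP ha (a.res_le _) fun x hx hxa => ⟨?_, hxa⟩,
      ihQ hb (b.res_le _) fun x hx hxb => ⟨?_, hxb⟩⟩
    · exact hdom x (Finset.mem_union_left _ hx) (hab.2.1.1 hxa)
    · exact hdom x (Finset.mem_union_right _ hx) (hab.2.2.1.1 hxb)
  | wand P Q ihP ihQ =>
    rw [sat_wand_iff] at h ⊢
    intro a r hr ha
    set V : Set rv := {x | Sum.inr x ∈ (wand P Q).fv} with hV
    have hP : ∀ x, Sum.inr x ∈ P.fv → x ∈ V := fun x hx => Finset.mem_union_left _ hx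
    have hQ : ∀ x, Sum.inr x ∈ Q.fv → x ∈ V := fun x hx => Finset.mem_union_right _ hx
    have hr' := (PMem.mem_indepProd_iff.1 hr).2
    have ha' : P.Sat (σ, a.res V) := ihP ha (a.res_le V) fun x hx hxa => ⟨hP x hx, hxa⟩
    -- `a` avoids `p.dom` but may meet `q.dom`; after restriction to free variables it cannot.
    have hd : Disjoint q.dom (a.res V).dom := by
      refine Set.disjoint_left.2 fun x hxq hxa => ?_
      exact Set.disjoint_left.1 hr'.1 (hdom x hxa.1 hxq) hxa.2
    obtain ⟨u, hu⟩ := PMem.exists_mem_indepProd hd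
    have hu' := PMem.mem_indepProd_iff.1 hu
    obtain ⟨t, htr, ht⟩ := (hr'.of_le (PMem.Le.refl p) (a.res_le V)).exists_le
    obtain ⟨t', htu, ht'⟩ := (hu'.2.of_le hle (PMem.Le.refl _)).exists_le
    -- `r` and `u` both project to the product of `p` with `a.res V`, which links them.
    obtain rfl := PMem.indepProd_unique ht ht'
    refine (ihQ (h _ u hu ha') htu fun x hx hxu => ?_).mono htr
    rw [(PMem.mem_indepProd_iff.1 ht).1]
    rw [hu'.1] at hxu
    exact hxu.imp (hdom x (hQ x hx)) id

/-- Satisfaction depends on the free deterministic variables only. -/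
theorem Sat.det_congr {P : Assertion D R} {σ σ' : DMem D} {p : PMem R} (h : P.Sat (σ, p))
    (hσ : ∀ x, Sum.inl x ∈ P.fv → σ x = σ' x) : P.Sat (σ', p) := by
  induction P generalizing σ σ' p with
  | atom a => exact (Atom.sat_iff (PMem.Le.refl p) (fun _ _ h => h) hσ).1 h
  | top => trivial
  | bot => exact h
  | and P Q ihP ihQ =>
    exact ⟨ihP h.1 fun x hx => hσ x (Finset.mem_union_left _ hx),
      ihQ h.2 fun x hx => hσ x (Finset.mem_union_right _ hx)⟩
  | or P Q ihP ihQ =>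
    exact h.imp (fun h => ihP h fun x hx => hσ x (Finset.mem_union_left _ hx))
      (fun h => ihQ h fun x hx => hσ x (Finset.mem_union_right _ hx))
  | imp P Q ihP ihQ =>
    rw [sat_imp_iff] at h ⊢
    exact fun q hq hP => ihQ (h q hq (ihP hP fun x hx =>
      (hσ x (Finset.mem_union_left _ hx)).symm)) fun x hx => hσ x (Finset.mem_union_right _ hx)
  | star P Q ihP ihQ =>
    rw [sat_star_iff] at h ⊢
    obtain ⟨a, b, hab, ha, hb⟩ := h
    exact ⟨a, b, hab, ihP ha fun x hx => hσ x (Finset.mem_union_left _ hx),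
      ihQ hb fun x hx => hσ x (Finset.mem_union_right _ hx)⟩
  | nstar P Q ihP ihQ =>
    rw [sat_nstar_iff] at h ⊢
    obtain ⟨a, b, hab, ha, hb⟩ := h
    exact ⟨a, b, hab, ihP ha fun x hx => hσ x (Finset.mem_union_left _ hx),
      ihQ hb fun x hx => hσ x (Finset.mem_union_right _ hx)⟩
  | wand P Q ihP ihQ =>
    rw [sat_wand_iff] at h ⊢
    exact fun q r hr hP => ihQ (h q r hr (ihP hP fun x hx =>
      (hσ x (Finset.mem_union_left _ hx)).symm)) fun x hx => hσ x (Finset.mem_union_right _ hx)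

/-- `⊨ P → Q` gives the implication in each configuration. -/
theorem sat_of_valid_imp {P Q : Assertion D R} (h : (P.imp Q).Valid) {γ : Config D R}
    (hP : P.Sat γ) : Q.Sat γ :=
  h γ γ ⟨rfl, PMem.Le.refl _⟩ hP

theorem mem_dom_of_sat_inVars {V : Finset (dv ⊕ rv)} {γ : Config D R} (h : (inVars V).Sat γ) {x : rv}
    (hx : Sum.inr x ∈ V) : x ∈ γ.2.dom := by
  have key : ∀ l : List (dv ⊕ rv), (l.foldr (fun y P => and (isIn (Expr.var y)) P) top).Sat γ →
      Sum.inr x ∈ l → x ∈ γ.2.dom := by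
    intro l
    induction l with
    | nil => simp
    | cons y l ih =>
      rintro ⟨h1, h2⟩ hx
      rcases List.mem_cons.1 hx with rfl | hx
      · obtain ⟨h, -⟩ := h1
        exact h x (by simp [Expr.var, Expr.fv])
      · exact ih h2 hx
  exact key _ h (Finset.mem_toList.2 hx)

theorem sat_bigOr_iff {l : List (Assertion D R)} {γ : Config D R} :
    (bigOr l).Sat γ ↔ ∃ P ∈ l, P.Sat γ := by
  induction l with
  | nil => simp [bigOr, Sat]
  | cons P l ih =>
    simp only [List.mem_cons, exists_eq_or_imp, ← ih]
    rfl

end Assertion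

/-! ### Substitution -/

theorem Expr.definedOn_subst {α : Type} {e : Expr D R α} {x : dv} {d : Expr D R (D x)}
    (hd : d.IsDet) {T : Set rv} : (e.subst x d).DefinedOn T ↔ e.DefinedOn T := by
  induction e with
  | dvar y =>
    have h1 : (Expr.dvar (R := R) (D := D) y).DefinedOn T := fun z hz => by simp [Expr.fv] at hz
    refine iff_of_true ?_ h1
    unfold Expr.subst
    split_ifs with h
    · subst h
      exact fun z hz => (hd z hz).elim
    · exact h1
  | rvar y => rfl
  | lit a => rfl
  | app f e ihf ihe =>
    have : ∀ {α β : Type} (f : Expr D R (α → β)) (e : Expr D R α),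
        (Expr.app f e).DefinedOn T ↔ f.DefinedOn T ∧ e.DefinedOn T := fun f e =>
      ⟨fun h => ⟨h.left, h.right⟩, fun h x hx => (Finset.mem_union.1 hx).elim (h.1 x) (h.2 x)⟩
    rw [Expr.subst, this, this, ihf, ihe]

theorem Expr.eval_subst {α : Type} {e : Expr D R α} {x : dv} {d : Expr D R (D x)}
    (hd : d.IsDet) {σ : DMem D} {T : Set rv} {m : RMem R T} (h : (e.subst x d).DefinedOn T)
    (h' : e.DefinedOn T) :
    (e.subst x d).eval σ m h = e.eval (Function.update σ x (d.evalDet hd σ)) m h' := by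
  induction e with
  | dvar y =>
    unfold Expr.subst at h ⊢
    by_cases hxy : x = y
    · subst hxy
      simp only [dif_pos]
      simp only [Expr.eval, Function.update_self]
      exact d.eval_congr _ _ (fun _ _ => rfl) fun z hz => (hd z hz).elim
    · simp only [dif_neg hxy]
      simp only [Expr.eval, Function.update_of_ne (Ne.symm hxy)]
  | rvar y => rfl
  | lit a => rfl
  | app f e ihf ihe =>
    simp only [Expr.subst, Expr.eval]
    rw [ihf, ihe]

theorem Atom.sat_subst_iff {a : Atom D R} {x : dv} {d : Expr D R (D x)} (hd : d.IsDet)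
    {σ : DMem D} {p : PMem R} :
    (a.subst x d).Sat (σ, p) ↔ a.Sat (Function.update σ x (d.evalDet hd σ), p) := by
  have hdist : ∀ {α : Type} (e : Expr D R α) (C : PMF α → Prop),
      ((∃ h : (e.subst x d).DefinedOn p.dom, C ((e.subst x d).dist σ p.μ h)) ↔
        ∃ h : e.DefinedOn p.dom, C (e.dist (Function.update σ x (d.evalDet hd σ)) p.μ h)) := by
    intro α e C
    refine exists_prop_iff (Expr.definedOn_subst hd) fun h h₁ => ?_
    unfold Expr.dist
    simp only [Expr.eval_subst hd h h₁]
  cases a with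
  | unif e T hT => exact hdist e (fun μ => μ = PMF.ofMultiset T hT)
  | bern e r => exact hdist e (fun μ => (μ 1).toReal = r ∧ (μ 0).toReal = 1 - r)
  | detm e => exact hdist e (fun μ => ∃ v, μ = PMF.pure v)
  | eq e e' =>
    refine exists_prop_iff (Expr.definedOn_subst hd) fun h h₁ => ?_
    refine exists_prop_iff (Expr.definedOn_subst hd) fun h' h'₁ => ?_
    simp only [Expr.eval_subst hd h h₁, Expr.eval_subst hd h' h'₁]
  | le e e' =>
    refine exists_prop_iff (Expr.definedOn_subst hd) fun h h₁ => ?_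
    refine exists_prop_iff (Expr.definedOn_subst hd) fun h' h'₁ => ?_
    simp only [Expr.eval_subst hd h h₁, Expr.eval_subst hd h' h'₁]
  | event e b =>
    refine exists_prop_iff (Expr.definedOn_subst hd) fun h h₁ => ?_
    simp only [Expr.eval_subst hd h h₁]
  | prob e r δ => exact hdist e (fun μ => r.holds (μ true).toReal δ)

theorem Assertion.sat_subst_iff [∀ x, Preorder (R x)] {P : Assertion D R} {x : dv}
    {d : Expr D R (D x)} (hd : d.IsDet) {σ : DMem D} {p : PMem R} :
    (P.subst x d).Sat (σ, p) ↔ P.Sat (Function.update σ x (d.evalDet hd σ), p) := by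
  induction P generalizing p with
  | atom a => exact Atom.sat_subst_iff hd
  | top => rfl
  | bot => rfl
  | and P Q ihP ihQ => exact and_congr ihP ihQ
  | or P Q ihP ihQ => exact or_congr ihP ihQ
  | imp P Q ihP ihQ => simp only [subst, sat_imp_iff, ihP, ihQ]
  | star P Q ihP ihQ => simp only [subst, sat_star_iff, ihP, ihQ]
  | nstar P Q ihP ihQ => simp only [subst, sat_nstar_iff, ihP, ihQ]
  | wand P Q ihP ihQ => simp only [subst, sat_wand_iff, ihP, ihQ]

/-! ### Kernels of commands

A well-formed, terminating command acts on the deterministic memory by a function and on the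
distribution by a kernel. -/

/-- The state transformer `f` acts by the function `F` and the kernel `K`. -/
def IsKernel (f : State D R → State D R) (F : DMem D → DMem D)
    (K : DMem D → RMem R Set.univ → PMF (RMem R Set.univ)) : Prop :=
  ∀ σ μ, f (σ, μ) = (F σ, μ.bind (K σ))

/-- Only variables in `V` are modified. -/
structure Modifies (V : Set (dv ⊕ rv)) (F : DMem D → DMem D)
    (K : DMem D → RMem R Set.univ → PMF (RMem R Set.univ)) : Prop where
  det : ∀ σ x, Sum.inl x ∉ V → F σ x = σ x
  rand : ∀ σ m, ∀ m' ∈ (K σ m).support, ∀ x : (Set.univ : Set rv), Sum.inr x.1 ∉ V → m' x = m x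

/-- Two deterministic memories agree on `A`. -/
def DetAgree (A : Set (dv ⊕ rv)) (σ σ' : DMem D) : Prop := ∀ x, Sum.inl x ∈ A → σ x = σ' x

/-- The part of a memory in `A`. -/
def onVars (A : Set (dv ⊕ rv)) (m : RMem R Set.univ) : RMem R {x | Sum.inr x ∈ A} :=
  RMem.restrict (Set.subset_univ _) m

theorem map_onVars_eq_of_subset {A B : Set (dv ⊕ rv)} (h : A ⊆ B) {μ μ' : PMF (RMem R Set.univ)}
    (hm : μ.map (onVars B) = μ'.map (onVars B)) : μ.map (onVars A) = μ'.map (onVars A) := by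
  have hsub : {x | Sum.inr x ∈ A} ⊆ {x | Sum.inr x ∈ B} := fun x hx => h hx
  have hA : onVars (R := R) A = RMem.restrict hsub ∘ onVars B := rfl
  rw [hA, ← PMF.map_comp, ← PMF.map_comp, hm]

/-- If the inputs agree on a set that contains `Rd`, then the outputs agree on this set and
on `Wr`. -/
def ReadsWrites (Rd Wr : Set (dv ⊕ rv)) (F : DMem D → DMem D)
    (K : DMem D → RMem R Set.univ → PMF (RMem R Set.univ)) : Prop :=
  ∀ A, Rd ⊆ A → ∀ σ σ' m m', DetAgree A σ σ' → onVars A m = onVars A m' →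
    DetAgree (A ∪ Wr) (F σ) (F σ') ∧
      (K σ m).map (onVars (A ∪ Wr)) = (K σ' m').map (onVars (A ∪ Wr))

variable {f g : State D R → State D R} {F G : DMem D → DMem D}
  {K L : DMem D → RMem R Set.univ → PMF (RMem R Set.univ)} {V Rd Wr Rd' Wr' : Set (dv ⊕ rv)}

theorem Modifies.mono (h : Modifies V F K) {V' : Set (dv ⊕ rv)} (hV : V ⊆ V') :
    Modifies V' F K :=
  ⟨fun σ x hx => h.det σ x fun hx' => hx (hV hx'),
    fun σ m m' hm x hx => h.rand σ m m' hm x fun hx' => hx (hV hx')⟩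

theorem ReadsWrites.mono (h : ReadsWrites Rd Wr F K) (hr : Rd ⊆ Rd') (hw : Wr' ⊆ Wr) :
    ReadsWrites Rd' Wr' F K := fun A hA σ σ' m m' hσ hm =>
  have hAW := Set.union_subset_union_right A hw
  have h' := h A (hr.trans hA) σ σ' m m' hσ hm
  ⟨fun x hx => h'.1 x (hAW hx), map_onVars_eq_of_subset hAW h'.2⟩

theorem isKernel_id : IsKernel (id : State D R → State D R) id fun _ => PMF.pure :=
  fun σ μ => by rw [PMF.bind_pure]; rfl

theorem modifies_id : Modifies (∅ : Set (dv ⊕ rv)) (id : DMem D → DMem D)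
    fun _ => PMF.pure (α := RMem R Set.univ) :=
  ⟨fun _ _ _ => rfl, fun σ m m' hm x _ => by rw [(PMF.mem_support_pure_iff _ _).1 hm]⟩

theorem readsWrites_id : ReadsWrites (∅ : Set (dv ⊕ rv)) ∅ (id : DMem D → DMem D)
    fun _ => PMF.pure (α := RMem R Set.univ) := by
  intro A _ σ σ' m m' hσ hm
  rw [Set.union_empty]
  refine ⟨hσ, ?_⟩
  rw [PMF.pure_map, PMF.pure_map, hm]

theorem IsKernel.comp (hf : IsKernel f F K) (hg : IsKernel g G L) :
    IsKernel (fun s => g (f s)) (fun σ => G (F σ)) fun σ m => (K σ m).bind (L (F σ)) :=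
  fun σ μ => by simp only [hf σ μ, hg _ _, PMF.bind_bind]

theorem Modifies.comp (hf : Modifies V F K) (hg : Modifies V G L) :
    Modifies V (fun σ => G (F σ)) fun σ m => (K σ m).bind (L (F σ)) := by
  refine ⟨fun σ x hx => (hg.det _ x hx).trans (hf.det _ x hx), fun σ m m' hm x hx => ?_⟩
  obtain ⟨m₁, h1, h2⟩ := (PMF.mem_support_bind_iff _ _ _).1 hm
  exact (hg.rand _ _ _ h2 x hx).trans (hf.rand _ _ _ h1 x hx)

/-- Quantifying over all `A` that contain the read set is what makes the property compose: the first
step enlarges the agreement from `A` to `A ∪ Wr`, and this contains `Rd'` as soon as `A` contains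
`Rd' \ Wr`. -/
theorem ReadsWrites.comp (hf : ReadsWrites Rd Wr F K) (hg : ReadsWrites Rd' Wr' G L) :
    ReadsWrites (Rd ∪ (Rd' \ Wr)) (Wr ∪ (Wr' \ Rd)) (fun σ => G (F σ))
      fun σ m => (K σ m).bind (L (F σ)) := by
  intro A hA σ σ' m m' hσ hm
  obtain ⟨h1, h2⟩ := hf A (Set.subset_union_left.trans hA) σ σ' m m' hσ hm
  have hRd' : Rd' ⊆ A ∪ Wr := fun x hx => by
    by_cases hw : x ∈ Wr
    · exact Or.inr hw
    · exact Or.inl (hA (Or.inr ⟨hx, hw⟩))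
  have hsub : A ∪ (Wr ∪ (Wr' \ Rd)) ⊆ A ∪ Wr ∪ Wr' := by
    rw [← Set.union_assoc]
    exact Set.union_subset_union_right _ Set.sdiff_subset
  -- The deterministic output ignores the randomized memory, but the hypothesis on the second step
  -- needs some memory to be instantiated.
  obtain ⟨m₀, -⟩ := (K σ m).support_nonempty
  refine ⟨fun x hx => (hg _ hRd' _ _ m₀ m₀ h1 rfl).1 x (hsub hx), ?_⟩
  refine map_onVars_eq_of_subset hsub ?_
  rw [PMF.map_bind, PMF.map_bind]
  exact PMF.bind_eq_bind_of_map_eq h2 fun a b hab => (hg _ hRd' _ _ a b h1 hab).2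

/-! #### Conditionals -/

theorem Expr.evalFull_eq_evalDet {α : Type} {e : Expr D R α} (h : e.IsDet) (σ : DMem D)
    (m : RMem R Set.univ) : e.evalFull σ m = e.evalDet h σ :=
  e.eval_congr _ _ (fun _ _ => rfl) fun x hx => (h x hx).elim

theorem Expr.distFull_eq_pure_iff {α : Type} {e : Expr D R α} {s : State D R} {v : α} :
    e.distFull s = PMF.pure v ↔ ∀ m ∈ s.2.support, e.evalFull s.1 m = v :=
  PMF.map_eq_pure_iff

/-- The action of a conditional on deterministic memories. -/
def condDet (b : Expr D R Bool) (F G : DMem D → DMem D) (σ : DMem D) : DMem D :=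
  -- Under a randomized guard neither branch of a well-formed command changes the deterministic
  -- memory, whence the last `σ`.
  if h : b.IsDet then if b.evalDet h σ then F σ else G σ else σ

/-- The kernel of a conditional. -/
def condKer (b : Expr D R Bool) (K L : DMem D → RMem R Set.univ → PMF (RMem R Set.univ))
    (σ : DMem D) (m : RMem R Set.univ) : PMF (RMem R Set.univ) :=
  if b.evalFull σ m then K σ m else L σ m

theorem condDet_of_eval {b : Expr D R Bool} (hdet : b.IsDet ∨ ∀ σ, F σ = σ ∧ G σ = σ) {σ : DMem D}
    (m : RMem R Set.univ) : condDet b F G σ = if b.evalFull σ m then F σ else G σ := by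
  unfold condDet
  by_cases h : b.IsDet
  · rw [dif_pos h, Expr.evalFull_eq_evalDet h]
  · rw [dif_neg h]
    have := hdet.resolve_left h σ
    split_ifs <;> simp [this]

/-- All three cases of the semantics are instances of choosing the branch memory by memory. An
almost surely constant guard selects one branch on the support; otherwise the convex combination of
the conditioned runs is the disintegration of `μ` along the guard. -/
theorem IsKernel.cond {b : Expr D R Bool} (hf : IsKernel f F K) (hg : IsKernel g G L)
    (hdet : b.IsDet ∨ ∀ σ, F σ = σ ∧ G σ = σ) :
    IsKernel (condSem b f g) (condDet b F G) (condKer b K L) := by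
  intro σ μ
  obtain ⟨m₀, hm₀⟩ := μ.support_nonempty
  unfold condSem
  split_ifs with ht hf'
  · have h := Expr.distFull_eq_pure_iff.1 ht
    dsimp only at h
    rw [hf, condDet_of_eval hdet m₀, h m₀ hm₀]
    refine Prod.ext rfl (PMF.bind_congr_support fun m hm => ?_)
    simp [condKer, h m hm]
  · have h := Expr.distFull_eq_pure_iff.1 hf'
    dsimp only at h
    rw [hg, condDet_of_eval hdet m₀, h m₀ hm₀]
    refine Prod.ext rfl (PMF.bind_congr_support fun m hm => ?_)
    simp [condKer, h m hm]
  · have hnd : ¬ b.IsDet := by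
      intro h
      have key : ∀ v, b.evalDet h σ = v → b.distFull (σ, μ) = PMF.pure v := fun v hv =>
        Expr.distFull_eq_pure_iff.2 fun m _ => (Expr.evalFull_eq_evalDet h σ m).trans hv
      cases hv : b.evalDet h σ
      · exact hf' (key _ hv)
      · exact ht (key _ hv)
    refine Prod.ext (by simp [condDet, hnd]) ?_
    have h1 : ∃ m ∈ {m | b.evalFull σ m = true}, m ∈ μ.support := exists_eval_of_dist_ne hf'
    have h2 : ∃ m ∈ {m | b.evalFull σ m = false}, m ∈ μ.support := exists_eval_of_dist_ne ht
    have hb : (μ.map (b.evalFull σ)).bind (fun v => (condDist μ (b.evalFull σ) v).bind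
        (condKer b K L σ)) = μ.bind (condKer b K L σ) := by
      rw [← PMF.bind_bind, map_bind_condDist]
    dsimp only
    rw [← hb, hf, hg]
    ext a
    rw [PMF.bind_bool]
    have e1 : (condDist μ (b.evalFull σ) true).bind (condKer b K L σ) =
        (μ.filter {m | b.evalFull σ m = true} h1).bind (K σ) := by
      rw [condDist_eq_filter h1]
      refine PMF.bind_congr_support fun m hm => ?_
      have : b.evalFull σ m = true := ((PMF.mem_support_filter_iff _).1 hm).1
      simp [condKer, this]
    have e2 : (condDist μ (b.evalFull σ) false).bind (condKer b K L σ) =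
        (μ.filter {m | b.evalFull σ m = false} h2).bind (L σ) := by
      rw [condDist_eq_filter h2]
      refine PMF.bind_congr_support fun m hm => ?_
      have : b.evalFull σ m = false := ((PMF.mem_support_filter_iff _).1 hm).1
      simp [condKer, this]
    rw [e1, e2]
    rfl

theorem Modifies.cond {b : Expr D R Bool} (hf : Modifies V F K) (hg : Modifies V G L) :
    Modifies V (condDet b F G) (condKer b K L) := by
  refine ⟨fun σ x hx => ?_, fun σ m m' hm x hx => ?_⟩
  · unfold condDet
    split_ifs
    · exact hf.det σ x hx
    · exact hg.det σ x hx
    · rfl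
  · unfold condKer at hm
    split_ifs at hm
    · exact hf.rand σ m m' hm x hx
    · exact hg.rand σ m m' hm x hx

theorem ReadsWrites.cond {b : Expr D R Bool} (hf : ReadsWrites Rd Wr F K)
    (hg : ReadsWrites Rd' Wr' G L) (hdet : b.IsDet ∨ ∀ σ, F σ = σ ∧ G σ = σ) :
    ReadsWrites (b.fv ∪ Rd ∪ Rd') ((Wr ∩ Wr') \ b.fv) (condDet b F G) (condKer b K L) := by
  intro A hA σ σ' m m' hσ hm
  have hb : b.evalFull σ m = b.evalFull σ' m' :=
    b.eval_congr _ _ (fun x hx => hσ x (hA (Or.inl (Or.inl hx)))) fun x hx =>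
      congrFun hm ⟨x, hA (Or.inl (Or.inl hx))⟩
  have h1 := hf.mono (Rd' := Rd) (Wr' := (Wr ∩ Wr') \ b.fv) subset_rfl (Set.sdiff_subset.trans Set.inter_subset_left) A
    ((Set.subset_union_right.trans Set.subset_union_left).trans hA) σ σ' m m' hσ hm
  have h2 := hg.mono (Rd' := Rd') (Wr' := (Wr ∩ Wr') \ b.fv) subset_rfl (Set.sdiff_subset.trans Set.inter_subset_right) A
    (Set.subset_union_right.trans hA) σ σ' m m' hσ hm
  rw [condDet_of_eval hdet m, condDet_of_eval hdet m']
  unfold condKer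
  rw [← hb]
  split_ifs
  · exact h1
  · exact h2

/-! #### Loops -/

/-- The kernel of the iterates of `(F, K)`. -/
def iterKer (F : DMem D → DMem D) (K : DMem D → RMem R Set.univ → PMF (RMem R Set.univ)) :
    ℕ → DMem D → RMem R Set.univ → PMF (RMem R Set.univ)
  | 0 => fun _ => PMF.pure
  | n + 1 => fun σ m => (iterKer F K n σ m).bind (K (F^[n] σ))

theorem IsKernel.iterate (hf : IsKernel f F K) (n : ℕ) : IsKernel f^[n] F^[n] (iterKer F K n) := by
  induction n with
  | zero => exact isKernel_id
  | succ n ih =>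
    rw [Function.iterate_succ', Function.iterate_succ']
    exact ih.comp hf

theorem Modifies.iterate (hf : Modifies V F K) (n : ℕ) : Modifies V F^[n] (iterKer F K n) := by
  induction n with
  | zero => exact modifies_id.mono (Set.empty_subset _)
  | succ n ih =>
    rw [Function.iterate_succ']
    exact ih.comp hf

theorem ReadsWrites.iterate (hf : ReadsWrites Rd ∅ F K) (n : ℕ) :
    ReadsWrites Rd ∅ F^[n] (iterKer F K n) := by
  induction n with
  | zero => exact readsWrites_id.mono (Set.empty_subset _) subset_rfl
  | succ n ih =>
    rw [Function.iterate_succ']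
    exact (ih.comp hf).mono (by simp) (by simp)

/-- Dominated convergence for the counting measure, with `μ` as the bound. The stage from which `κ n
a` is constant may depend on `a`, as the stopping time of a loop does on the initial memory. -/
theorem tendsto_bind_apply {α β : Type} (μ : PMF α) {κ : ℕ → α → PMF β} {κ' : α → PMF β}
    (h : ∀ a, ∀ᶠ n in Filter.atTop, κ n a = κ' a) (b : β) :
    Filter.Tendsto (fun n => μ.bind (κ n) b) Filter.atTop (nhds (μ.bind κ' b)) := by
  let _ : MeasurableSpace α := ⊤
  simp only [PMF.bind_apply]
  simp only [← MeasureTheory.lintegral_count]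
  refine MeasureTheory.tendsto_lintegral_of_dominated_convergence (fun a => μ a)
    (fun n => measurable_from_top) (fun n => Filter.Eventually.of_forall fun a => ?_) ?_
    (Filter.Eventually.of_forall fun a => ?_)
  · exact mul_le_of_le_one_right' (PMF.coe_le_one _ _)
  · rw [MeasureTheory.lintegral_count, μ.tsum_coe]
    exact ENNReal.one_ne_top
  · refine tendsto_const_nhds.congr' ?_
    filter_upwards [h a] with n hn
    rw [hn]

/-- Makes loop limits unique: any memory in the support reveals the deterministic component. -/
theorem State.ext_of_weight {s t : State D R} (h : ∀ σ m, s.weight σ m = t.weight σ m) :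
    s = t := by
  obtain ⟨m, hm⟩ := s.2.support_nonempty
  have h1 := h s.1 m
  simp only [State.weight, if_true] at h1
  have h2 : t.1 = s.1 := by
    by_contra hne
    rw [if_neg hne] at h1
    exact hm h1
  refine Prod.ext h2.symm (PMF.ext fun m' => ?_)
  have h3 := h s.1 m'
  simpa only [State.weight, if_true, if_pos h2] using h3

theorem loopSem_eq_of_isLoopLimit {b : Expr D R Bool} {s t : State D R}
    (h : IsLoopLimit b f s t) : loopSem b f s = t := by
  have hex : ∃ t, IsLoopLimit b f s t := ⟨t, h⟩
  rw [loopSem, dif_pos hex]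
  exact State.ext_of_weight fun σ m => tendsto_nhds_unique (hex.choose_spec σ m) (h σ m)

/-- The guard is false after `n` iterations from `(σ, m)`. -/
def DoneAt (b : Expr D R Bool) (F : DMem D → DMem D)
    (K : DMem D → RMem R Set.univ → PMF (RMem R Set.univ)) (n : ℕ) (σ : DMem D)
    (m : RMem R Set.univ) : Prop :=
  ∀ m' ∈ (iterKer (condDet b F id) (condKer b K fun _ => PMF.pure) n σ m).support,
    b.evalFull ((condDet b F id)^[n] σ) m' = false

/-- Once the guard is false on all outcomes, each further iteration runs the empty branch. -/
theorem DoneAt.stable {b : Expr D R Bool} (hdet : b.IsDet ∨ ∀ σ, F σ = σ) {n : ℕ} {σ : DMem D}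
    {m : RMem R Set.univ} (h : DoneAt b F K n σ m) (k : ℕ) (hk : n ≤ k) :
    (condDet b F id)^[k] σ = (condDet b F id)^[n] σ ∧
      iterKer (condDet b F id) (condKer b K fun _ => PMF.pure) k σ m =
        iterKer (condDet b F id) (condKer b K fun _ => PMF.pure) n σ m := by
  induction k, hk using Nat.le_induction with
  | base => exact ⟨rfl, rfl⟩
  | succ k hk ih =>
    obtain ⟨h1, h2⟩ := ih
    obtain ⟨m₀, hm₀⟩ := (iterKer (condDet b F id) (condKer b K fun _ => PMF.pure) n σ m).support_nonempty
    constructor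
    · rw [Function.iterate_succ_apply', h1,
        condDet_of_eval (G := id) (hdet.imp_right fun h σ => ⟨h σ, rfl⟩) m₀, h m₀ hm₀]
      rfl
    · simp only [iterKer]
      rw [h1, h2]
      conv_rhs => rw [← PMF.bind_pure (iterKer _ _ n σ m)]
      refine PMF.bind_congr_support fun m' hm' => ?_
      simp [condKer, h m' hm']

/-- The kernel of the loop at `m` is that of the iterate at which `m` is done. The deterministic
output does not depend on `m`: the iterates for two memories agree at the larger of their stopping
times. The last clause of the conclusion is separate because it must hold even if there is no
randomized memory at all. -/
theorem exists_isKernel_loop {b : Expr D R Bool} (hf : IsKernel f F K)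
    (hdet : b.IsDet ∨ ∀ σ, F σ = σ) (hdone : ∀ σ m, ∃ n, DoneAt b F K n σ m) :
    ∃ F' K', IsKernel (loopSem b f) F' K' ∧
      (∀ σ m, ∃ n, F' σ = (condDet b F id)^[n] σ ∧ ∀ k, n ≤ k → F' σ = (condDet b F id)^[k] σ ∧
        K' σ m = iterKer (condDet b F id) (condKer b K fun _ => PMF.pure) k σ m) ∧
      (∀ σ, ∃ n, F' σ = (condDet b F id)^[n] σ) := by
  choose N hN using hdone
  set H := condDet b F id
  set J := condKer b K fun _ => PMF.pure
  have hker : ∀ n, IsKernel (iterSem b f n) H^[n] (iterKer H J n) :=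
    (hf.cond isKernel_id (hdet.imp_right fun h σ => ⟨h σ, rfl⟩)).iterate
  have hstab : ∀ σ m m', H^[N σ m] σ = H^[N σ m'] σ := by
    intro σ m m'
    rw [← ((hN σ m).stable hdet (max (N σ m) (N σ m')) (le_max_left _ _)).1,
      ← ((hN σ m').stable hdet (max (N σ m) (N σ m')) (le_max_right _ _)).1]
  -- If some value type is empty, there are no memories and no states, and the value of `F'` is
  -- immaterial.
  let F' : DMem D → DMem D := fun σ =>
    if h : Nonempty (RMem R Set.univ) then H^[N σ h.some] σ else σ
  have hF' : ∀ σ m, F' σ = H^[N σ m] σ := by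
    intro σ m
    have h : Nonempty (RMem R Set.univ) := ⟨m⟩
    simp only [F', dif_pos h]
    exact hstab _ _ _
  refine ⟨F', fun σ m => iterKer H J (N σ m) σ m, ?_, ?_, ?_⟩
  · intro σ μ
    apply loopSem_eq_of_isLoopLimit
    intro τ m'
    obtain ⟨m₀, -⟩ := μ.support_nonempty
    have hev : ∀ᶠ n in Filter.atTop, H^[n] σ = F' σ := by
      filter_upwards [Filter.eventually_ge_atTop (N σ m₀)] with n hn
      rw [hF' σ m₀, ((hN σ m₀).stable hdet n hn).1]
    have hlim := tendsto_bind_apply μ (κ := fun n => iterKer H J n σ)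
      (κ' := fun m => iterKer H J (N σ m) σ m) (fun m => by
        filter_upwards [Filter.eventually_ge_atTop (N σ m)] with n hn
        exact ((hN σ m).stable hdet n hn).2) m'
    have hweight : ∀ n, H^[n] σ = F' σ → abortWeight b (iterSem b f n (σ, μ)) τ m' =
        if b.evalFull (F' σ) m' = false ∧ F' σ = τ then μ.bind (iterKer H J n σ) m' else 0 := by
      intro n hn
      rw [hker n, abortWeight, State.weight]
      dsimp only
      rw [hn, ite_and]
    have hev' := hev.mono hweight
    refine Filter.Tendsto.congr' (hev'.mono fun _ h => h.symm) ?_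
    rw [State.weight]
    dsimp only
    by_cases hτ : F' σ = τ
    · by_cases hb : b.evalFull (F' σ) m' = false
      · simpa only [hτ ▸ hb, hτ, and_self, if_true] using hlim
      -- The limit has no mass where the guard is true, so discarding the unfinished outcomes loses
      -- nothing in the limit.
      · have hz : (μ.bind fun m => iterKer H J (N σ m) σ m) m' = 0 := by
          rw [PMF.apply_eq_zero_iff]
          intro hm'
          obtain ⟨m, -, hm⟩ := (PMF.mem_support_bind_iff _ _ _).1 hm'
          apply hb
          rw [hF' σ m]
          exact hN σ m m' hm
        simp [hb, hz]
    · simp [hτ]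
  · intro σ m
    refine ⟨N σ m, hF' σ m, fun k hk => ?_⟩
    obtain ⟨h1, h2⟩ := (hN σ m).stable hdet k hk
    exact ⟨(hF' σ m).trans h1.symm, h2.symm⟩
  · intro σ
    by_cases h : Nonempty (RMem R Set.univ)
    · exact ⟨_, dif_pos h⟩
    · exact ⟨0, dif_neg h⟩

/-! #### Commands -/

theorem Com.writev_subset_mv (c : Com D R) : c.writev ⊆ c.mv := by
  unfold Com.writev
  induction c with
  | skip => exact subset_rfl
  | dassn x e he => exact Finset.sdiff_subset
  | rassn x e => exact Finset.sdiff_subset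
  | samp x T hT => exact subset_rfl
  | seq c c' ih ih' =>
    exact Finset.union_subset_union ih (Finset.sdiff_subset.trans ih')
  | cond b c c' ih ih' =>
    exact (Finset.sdiff_subset.trans Finset.inter_subset_left).trans
      (ih.trans Finset.subset_union_left)
  | loop b c ih => exact Finset.empty_subset _

/-- `(F, K)` is the semantics of `c`, with the expected effect on the variables. -/
structure Com.HasKernel (c : Com D R) (F : DMem D → DMem D)
    (K : DMem D → RMem R Set.univ → PMF (RMem R Set.univ)) : Prop where
  sem : IsKernel c.sem F K
  mod : Modifies c.mv F K
  rw : ReadsWrites c.readv c.writev F K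

theorem Modifies.eq_id (h : Modifies V F K) (hV : ∀ x, Sum.inl x ∉ V) (σ : DMem D) : F σ = σ :=
  funext fun x => h.det σ x (hV x)

theorem Com.exists_hasKernel (c : Com D R) (hwf : c.WellFormed) (hterm : c.Terminates) :
    ∃ F K, c.HasKernel F K := by
  induction c with
  | skip => exact ⟨id, fun _ => PMF.pure, isKernel_id, by simpa [Com.mv] using modifies_id,
      by simpa [Com.readv, Com.writev, Com.rwv] using readsWrites_id⟩
  | dassn x e he =>
    refine ⟨fun σ => Function.update σ x (e.evalDet he σ), fun _ => PMF.pure, ?_, ?_, ?_⟩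
    · intro σ μ
      rw [PMF.bind_pure]
      rfl
    · refine ⟨fun σ y hy => ?_, fun σ m m' hm y _ => ?_⟩
      · have : y ≠ x := fun h => hy (by simp [Com.mv, h])
        exact Function.update_of_ne this _ _
      · rw [(PMF.mem_support_pure_iff _ _).1 hm]
    · have hr : (Com.dassn x e he).readv = e.fv := rfl
      have hw : (Com.dassn x e he).writev ⊆ {Sum.inl x} := Finset.sdiff_subset
      intro A hA σ σ' m m' hσ hm
      refine ⟨fun y hy => ?_, ?_⟩
      · by_cases hyx : y = x
        · subst hyx
          simp only [Function.update_self]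
          exact e.eval_congr _ _ (fun z hz => hσ z (hA hz)) fun z hz => (he z hz).elim
        · simp only [Function.update_of_ne hyx]
          refine hσ y (hy.resolve_right fun h => hyx ?_)
          simpa using hw h
      · rw [PMF.pure_map, PMF.pure_map]
        congr 1
        funext y
        refine congrFun hm ⟨y.1, y.2.resolve_right fun h => ?_⟩
        simpa using hw h
  | rassn x e =>
    refine ⟨id, fun σ m => PMF.pure (Function.update m ⟨x, trivial⟩ (e.evalFull σ m)),
      fun σ μ => rfl, ?_, ?_⟩
    · refine ⟨fun σ y hy => rfl, fun σ m m' hm y hy => ?_⟩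
      have : y ≠ ⟨x, trivial⟩ := fun h => hy (by simp [Com.mv, h])
      rw [(PMF.mem_support_pure_iff _ _).1 hm, Function.update_of_ne this]
    · have hr : (Com.rassn x e).readv = e.fv := rfl
      have hw : (Com.rassn x e).writev ⊆ {Sum.inr x} := Finset.sdiff_subset
      intro A hA σ σ' m m' hσ hm
      refine ⟨fun y hy => hσ y (hy.resolve_right fun h => by simpa using hw h), ?_⟩
      rw [PMF.pure_map, PMF.pure_map]
      congr 1
      funext ⟨y, hy⟩
      by_cases hyx : y = x
      · subst hyx
        simp only [onVars, RMem.restrict, Function.update_self]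
        exact e.eval_congr _ _ (fun z hz => hσ z (hA hz)) fun z hz => congrFun hm ⟨z, hA hz⟩
      · have : (⟨y, trivial⟩ : (Set.univ : Set rv)) ≠ ⟨x, trivial⟩ :=
          fun h => hyx (congrArg Subtype.val h)
        simp only [onVars, RMem.restrict, Function.update_of_ne this]
        exact congrFun hm ⟨y, hy.resolve_right fun h => hyx (by simpa using hw h)⟩
  | samp x T hT =>
    refine ⟨id, fun σ m => (PMF.ofMultiset T hT).bind fun v =>
        PMF.pure (Function.update m ⟨x, trivial⟩ v), fun σ μ => rfl, ?_, ?_⟩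
    · refine ⟨fun σ y hy => rfl, fun σ m m' hm y hy => ?_⟩
      have : y ≠ ⟨x, trivial⟩ := fun h => hy (by simp [Com.mv, h])
      obtain ⟨v, -, hv⟩ := (PMF.mem_support_bind_iff _ _ _).1 hm
      rw [(PMF.mem_support_pure_iff _ _).1 hv, Function.update_of_ne this]
    · have hw : (Com.samp (D := D) x T hT).writev = {Sum.inr x} := rfl
      intro A hA σ σ' m m' hσ hm
      refine ⟨fun y hy => hσ y (hy.resolve_right fun h => by simp [hw] at h), ?_⟩
      simp only [PMF.map_bind, PMF.pure_map]
      congr 1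
      funext v
      congr 1
      funext ⟨y, hy⟩
      by_cases hyx : y = x
      · subst hyx
        simp only [onVars, RMem.restrict, Function.update_self]
      · have : (⟨y, trivial⟩ : (Set.univ : Set rv)) ≠ ⟨x, trivial⟩ :=
          fun h => hyx (congrArg Subtype.val h)
        simp only [onVars, RMem.restrict, Function.update_of_ne this]
        exact congrFun hm ⟨y, hy.resolve_right fun h => hyx (by simpa [hw] using h)⟩
  | seq c c' ih ih' =>
    obtain ⟨F, K, h⟩ := ih hwf.1 hterm.1
    obtain ⟨F', K', h'⟩ := ih' hwf.2 hterm.2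
    refine ⟨_, _, h.sem.comp h'.sem, (h.mod.mono ?_).comp (h'.mod.mono ?_), ?_⟩
    · simp [Com.mv]
    · simp [Com.mv]
    · simpa [Com.readv, Com.writev, Com.rwv] using h.rw.comp h'.rw
  | cond b c c' ih ih' =>
    obtain ⟨F, K, h⟩ := ih hwf.1 hterm.1
    obtain ⟨F', K', h'⟩ := ih' hwf.2.1 hterm.2
    have hdet : b.IsDet ∨ ∀ σ, F σ = σ ∧ F' σ = σ := hwf.2.2.imp_right fun hx σ =>
      ⟨h.mod.eq_id (fun x => (hx x).1) σ, h'.mod.eq_id (fun x => (hx x).2) σ⟩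
    refine ⟨_, _, h.sem.cond h'.sem hdet, (h.mod.mono ?_).cond (h'.mod.mono ?_), ?_⟩
    · simp [Com.mv]
    · simp [Com.mv]
    · simpa [Com.readv, Com.writev, Com.rwv, Set.union_assoc] using h.rw.cond h'.rw hdet
  | loop b c ih =>
    obtain ⟨F, K, h⟩ := ih hwf.1 hterm.1
    have hdet : b.IsDet ∨ ∀ σ, F σ = σ := hwf.2.imp_right fun hx => h.mod.eq_id hx
    have hdet' : b.IsDet ∨ ∀ σ, F σ = σ ∧ id σ = σ := hdet.imp_right fun h σ => ⟨h σ, rfl⟩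
    have hker := (h.sem.cond isKernel_id hdet').iterate
    obtain ⟨F', K', h1, h2, h3⟩ := exists_isKernel_loop h.sem hdet fun σ m => by
      obtain ⟨n, hn⟩ := hterm.2 σ m
      refine ⟨n, fun m' hm' => ?_⟩
      -- At a point mass the iterated semantics is the iterated kernel, which turns the termination
      -- hypothesis into `DoneAt`.
      have he : iterSem b c.sem n (σ, PMF.pure m) = _ := hker n σ (PMF.pure m)
      rw [PMF.pure_bind] at he
      rw [he] at hn
      exact hn m' hm'
    have hmod := (h.mod.cond (b := b) (modifies_id.mono (Set.empty_subset _))).iterate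
    have hrw := ((h.rw.cond readsWrites_id hdet').mono
      (Rd' := ((Com.loop b c).readv : Set (dv ⊕ rv))) (Wr' := ∅)
      (by simp [Com.readv, Com.rwv]) (Set.empty_subset _)).iterate
    refine ⟨F', K', h1, ⟨fun σ x hx => ?_, fun σ m m' hm x hx => ?_⟩, ?_⟩
    · obtain ⟨n, hn⟩ := h3 σ
      rw [hn]
      exact (hmod n).det σ x hx
    · obtain ⟨n, -, hn⟩ := h2 σ m
      rw [(hn n le_rfl).2] at hm
      exact (hmod n).rand σ m m' hm x hx
    · intro A hA σ σ' m m' hσ hm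
      obtain ⟨n, -, hn⟩ := h2 σ m
      obtain ⟨n', -, hn'⟩ := h2 σ' m'
      -- The two runs may stop at different times; at the maximum both are given by the same
      -- iterate.
      obtain ⟨e1, e2⟩ := hn (max n n') (le_max_left _ _)
      obtain ⟨e3, e4⟩ := hn' (max n n') (le_max_right _ _)
      rw [e1, e2, e3, e4]
      have hw : (((Com.loop b c).writev : Finset (dv ⊕ rv)) : Set (dv ⊕ rv)) = ∅ := Finset.coe_empty
      rw [hw]
      exact hrw (max n n') A hA σ σ' m m' hσ hm

/-! ### Independence, conditioning and commands -/

theorem condDist_apply {α β : Type} {μ : PMF α} {g : α → β} {b : β} (hb : b ∈ (μ.map g).support)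
    (a : α) : μ.map g b * condDist μ g b a = if g a = b then μ a else 0 := by
  split_ifs with h
  · conv_rhs => rw [← map_bind_condDist μ g]
    rw [PMF.bind_apply, tsum_eq_single b]
    intro b' hb'
    by_cases hs : b' ∈ (μ.map g).support
    · have : a ∉ (condDist μ g b').support := fun h' =>
        hb' (((mem_support_condDist hs).1 h').1.symm.trans h)
      rw [(PMF.apply_eq_zero_iff _ _).2 this, mul_zero]
    · rw [(PMF.apply_eq_zero_iff _ _).2 hs, zero_mul]
  · have : a ∉ (condDist μ g b).support := fun h' => h ((mem_support_condDist hb).1 h').1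
    rw [(PMF.apply_eq_zero_iff _ _).2 this, mul_zero]

/-- Conditioning on an independent value does not change the distribution. -/
theorem map_condDist_of_indep {α β γ : Type} {μ : PMF α} {f : α → γ} {g : α → β} {p : PMF γ}
    {q : PMF β} (h : μ.map (fun a => (f a, g a)) = prodPMF p q) {b : β} (hb : b ∈ q.support) :
    (condDist μ g b).map f = p := by
  have hq : μ.map g = q := by
    rw [← prodPMF_map_snd p q, ← h, PMF.map_comp]
    rfl
  have hb' : b ∈ (μ.map g).support := hq ▸ hb
  ext x
  have h1 : q b * (condDist μ g b).map f x = q b * p x := by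
    have h0 : q b * p x = μ.map (fun a => (f a, g a)) (x, b) := by
      rw [h, prodPMF_apply, mul_comm]
    rw [h0, PMF.map_apply, PMF.map_apply, ← ENNReal.tsum_mul_left]
    refine tsum_congr fun a => ?_
    have := condDist_apply hb' a
    rw [hq] at this
    rw [mul_ite, mul_zero, this]
    simp only [Prod.mk.injEq, ite_and, eq_comm]
  exact (ENNReal.mul_right_inj ((PMF.mem_support_iff _ _).1 hb) (PMF.apply_ne_top _ _)).1 h1

namespace PMem

open RMem

/-- A distribution on all randomized variables. -/
def full (μ : PMF (RMem R Set.univ)) : PMem R := ⟨Set.univ, μ⟩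

theorem IndepIn.symm {p q r : PMem R} (h : p.IndepIn q r) : q.IndepIn p r := by
  obtain ⟨hd, hp, hq, h⟩ := h
  refine ⟨hd.symm, hq, hp, ?_⟩
  have h1 : (prodPMF p.μ q.μ).map Prod.swap = prodPMF q.μ p.μ := by
    simp only [prodPMF, PMF.map_bind, PMF.map_comp]
    exact PMF.bind_comm p.μ q.μ fun a b => PMF.pure (b, a)
  rw [← h1, ← h, PMF.map_comp]
  rfl

/-- The memory without variables. -/
def empty : PMem R := ⟨∅, PMF.pure fun x => x.2.elim⟩

/-- Supplies the independent input part of a command that reads nothing, such as sampling. -/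
theorem empty_indepIn {q r : PMem R} (h : q.Le r) : (empty : PMem R).IndepIn q r := by
  obtain ⟨h1, h2⟩ := h
  refine ⟨Set.empty_disjoint _, Set.empty_subset _, h1, ?_⟩
  simp only [empty, prodPMF, PMF.pure_bind]
  rw [← h2, proj, PMF.map_comp]
  refine PMF.map_congr_support fun m _ => Prod.ext ?_ rfl
  funext x
  exact x.2.elim

end PMem

/-! ### Unmodified and independent parts under kernels. -/

theorem Modifies.le_out {V : Set (dv ⊕ rv)} {F : DMem D → DMem D}
    {K : DMem D → RMem R Set.univ → PMF (RMem R Set.univ)} (h : Modifies V F K)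
    {q : PMem R} {σ : DMem D} {μ : PMF (RMem R Set.univ)} (hq : q.Le (PMem.full μ))
    (hV : ∀ x ∈ q.dom, Sum.inr x ∉ V) : q.Le (PMem.full (μ.bind (K σ))) := by
  obtain ⟨(h1 : q.dom ⊆ Set.univ), h2⟩ := hq
  refine ⟨h1, ?_⟩
  rw [← h2]
  change (μ.bind (K σ)).map (RMem.restrict h1) = μ.bind (PMF.pure ∘ RMem.restrict h1)
  rw [PMF.map_bind]
  refine PMF.bind_congr_support fun m _ => ?_
  refine PMF.map_eq_pure_iff.2 fun m' hm' => ?_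
  funext x
  exact h.rand σ m m' hm' ⟨x.1, trivial⟩ (hV x.1 x.2)

/-- An assertion without modified variables remains valid. -/
theorem Modifies.exists_sat [∀ x, Preorder (R x)] {V : Finset (dv ⊕ rv)} {F : DMem D → DMem D}
    {K : DMem D → RMem R Set.univ → PMF (RMem R Set.univ)} (h : Modifies V F K)
    {q : PMem R} {σ : DMem D} {μ : PMF (RMem R Set.univ)} (hq : q.Le (PMem.full μ))
    {η : Assertion D R} (hη : η.Sat (σ, q)) (hV : Disjoint η.fv V) :
    ∃ q' : PMem R, q'.Le q ∧ q'.Le (PMem.full (μ.bind (K σ))) ∧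
      (∀ x ∈ q'.dom, Sum.inr x ∈ η.fv) ∧ η.Sat (F σ, q') := by
  -- `q` may also contain modified variables; its part on the free variables of `η` does not, so its
  -- law is unchanged.
  have hle := q.res_le {x | Sum.inr x ∈ η.fv}
  refine ⟨_, hle, h.le_out (hle.trans hq) fun x hx hx' => Finset.disjoint_left.1 hV hx.1 hx',
    fun x hx => hx.1, ?_⟩
  refine (hη.of_le hle fun x hx hxq => ⟨hx, hxq⟩).det_congr fun x hx => ?_
  exact (h.det σ x (Finset.disjoint_left.1 hV hx)).symm

/-- Given the input, the output law on `p.dom` and `Wr` depends only on the part in `p.dom`, while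
the part in `q.dom` is copied. Hence the joint law is a kernel applied to the first factor of a
product, which is again a product. -/
theorem ReadsWrites.indepIn {V Rd Wr : Set (dv ⊕ rv)} {F : DMem D → DMem D}
    {K : DMem D → RMem R Set.univ → PMF (RMem R Set.univ)} (hrw : ReadsWrites Rd Wr F K)
    (hmod : Modifies V F K) (hWr : Wr ⊆ V) {p q : PMem R} {σ : DMem D}
    {μ : PMF (RMem R Set.univ)} (h : p.IndepIn q (PMem.full μ))
    (hRd : ∀ x, Sum.inr x ∈ Rd → x ∈ p.dom) (hV : ∀ x ∈ q.dom, Sum.inr x ∉ V) :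
    ∃ p' : PMem R, (∀ x, x ∈ p'.dom ↔ x ∈ p.dom ∨ Sum.inr x ∈ Wr) ∧
      p'.IndepIn q (PMem.full (μ.bind (K σ))) := by
  obtain ⟨hd, (hp : p.dom ⊆ Set.univ), (hq : q.dom ⊆ Set.univ), h⟩ := h
  change μ.map (fun m => (RMem.restrict hp m, RMem.restrict hq m)) = _ at h
  -- All deterministic variables are included in `A`; agreement on them is free, as all runs start
  -- from the same `σ`.
  set A : Set (dv ⊕ rv) := {y | ∀ x, y = Sum.inr x → x ∈ p.dom} with hA
  have hAp : ∀ x, Sum.inr x ∈ A ↔ x ∈ p.dom := fun x =>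
    ⟨fun hx => hx x rfl, fun hx y hy => by cases hy; exact hx⟩
  have hRdA : Rd ⊆ A := fun y hy x hx => hRd x (hx ▸ hy)
  set κ := fun m => (K σ m).map (onVars (A ∪ Wr)) with hκ
  obtain ⟨m₀, -⟩ := μ.support_nonempty
  have hfac : κ.FactorsThrough (RMem.restrict hp) := by
    intro m m' hm
    refine (hrw A hRdA σ σ m m' (fun _ _ => rfl) ?_).2
    funext x
    exact congrFun hm ⟨x.1, (hAp _).1 x.2⟩
  have : Nonempty (PMF (RMem R {x | Sum.inr x ∈ A ∪ Wr})) := ⟨κ m₀⟩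
  obtain ⟨κ', hκ'⟩ := (Function.factorsThrough_iff _).1 hfac
  have hpμ : p.μ = μ.map (RMem.restrict hp) := by
    rw [← prodPMF_map_fst p.μ q.μ, ← h, PMF.map_comp]
    rfl
  refine ⟨⟨{x | Sum.inr x ∈ A ∪ Wr}, μ.bind κ⟩, fun x => or_congr (hAp x) Iff.rfl, ?_,
    Set.subset_univ _, hq, ?_⟩
  · refine Set.disjoint_left.2 fun x hx hxq => ?_
    rcases hx with hx | hx
    · exact Set.disjoint_left.1 hd ((hAp x).1 hx) hxq
    · exact hV x hxq (hWr hx)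
  · have h1 : (μ.bind (K σ)).map (fun m => (onVars (A ∪ Wr) m, RMem.restrict hq m)) =
        μ.bind fun m => (κ' (RMem.restrict hp m)).map fun c => (c, RMem.restrict hq m) := by
      rw [PMF.map_bind]
      refine PMF.bind_congr_support fun m _ => ?_
      have : κ' (RMem.restrict hp m) = κ m := (congrFun hκ' m).symm
      rw [this, hκ, PMF.map_comp]
      refine PMF.map_congr_support fun m' hm' => Prod.ext rfl ?_
      funext x
      exact hmod.rand σ m m' hm' ⟨x.1, trivial⟩ (hV x.1 x.2)
    have h2 : (μ.bind fun m => (κ' (RMem.restrict hp m)).map fun c => (c, RMem.restrict hq m)) =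
        (prodPMF p.μ q.μ).bind fun x => (κ' x.1).map fun c => (c, x.2) := by
      rw [← h, PMF.bind_map]
      rfl
    have h3 : μ.bind κ = p.μ.bind κ' := by
      rw [hpμ, PMF.bind_map, hκ']
    refine (h1.trans h2).trans ?_
    rw [h3]
    simp only [prodPMF, PMF.bind_bind, PMF.bind_map]
    congr 1
    funext a
    exact PMF.bind_comm q.μ (κ' a) fun b c => PMF.pure (c, b)

/-- `CM` speaks of mixtures indexed by `ℕ`. The support of `ν` is countable, so it can be enumerated
injectively. -/
theorem Assertion.CM.bind [∀ x, Preorder (R x)] {P : Assertion D R} (h : P.CM) {β : Type}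
    {σ : DMem D} {T : Set rv} (ν : PMF β) (κ : β → PMF (RMem R T))
    (hκ : ∀ b ∈ ν.support, P.Sat (σ, ⟨T, κ b⟩)) : P.Sat (σ, ⟨T, ν.bind κ⟩) := by
  obtain ⟨b₀, hb₀⟩ := ν.support_nonempty
  have : Nonempty β := ⟨b₀⟩
  obtain ⟨enc, henc⟩ := Set.countable_iff_exists_injOn.1 ν.support_countable
  have hinv : ∀ b ∈ ν.support, Function.invFunOn enc ν.support (enc b) = b := fun b hb =>
    henc.leftInvOn_invFunOn hb
  have h1 := h σ T (ν.map enc) (fun i => κ (Function.invFunOn enc ν.support i)) fun i hi => by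
    obtain ⟨b, hb, rfl⟩ := (PMF.mem_support_map_iff _ _ _).1 hi
    rw [hinv b hb]
    exact hκ b hb
  rw [PMF.bind_map] at h1
  rwa [PMF.bind_congr_support (g := κ) fun b hb => by simp [hinv b hb]] at h1

/-! ### Soundness of the rules -/

theorem iterSem_stable {b : Expr D R Bool} {f : State D R → State D R} {s : State D R} {n : ℕ}
    (h : b.distFull (iterSem b f n s) = PMF.pure false) {k : ℕ} (hk : n ≤ k) :
    iterSem b f k s = iterSem b f n s := by
  induction k, hk using Nat.le_induction with
  | base => rfl
  | succ k hk ih =>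
    have h1 : iterSem b f (k + 1) s = condSem b f id (iterSem b f k s) :=
      Function.iterate_succ_apply' _ _ _
    have hne : b.distFull (iterSem b f n s) ≠ PMF.pure true := by
      rw [h]
      intro h'
      have : (false : Bool) ∈ (PMF.pure true).support := by
        rw [← h']
        simp
      simp at this
    rw [h1, ih, condSem, dif_neg hne, dif_pos h]
    rfl

section Rules

variable [∀ x, Preorder (R x)] {φ ψ η : Assertion D R} {c : Com D R}

theorem validJudgement_cond {b : Expr D R Bool} {c' : Com D R}
    (h : ValidJudgement (φ.and (.eq b (.lit true))) c ψ)
    (h' : ValidJudgement (φ.and (.eq b (.lit false))) c' ψ)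
    (hb : (φ.imp (.atom (.detm b))).Valid) : ValidJudgement φ (.cond b c c') ψ := by
  intro s hs
  obtain ⟨_, v, hv⟩ := Assertion.sat_of_valid_imp hb hs
  change b.distFull s = PMF.pure v at hv
  have hev := Expr.distFull_eq_pure_iff.1 hv
  have heq : (Assertion.eq b (.lit v)).Sat s.toConfig :=
    ⟨b.definedOn_univ, Expr.definedOn_univ _, fun m hm => hev m hm⟩
  change ψ.Sat (condSem b c.sem c'.sem s).toConfig
  unfold condSem
  cases v with
  | true =>
    rw [dif_pos hv]
    exact h s ⟨hs, heq⟩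
  | false =>
    have hne : b.distFull s ≠ PMF.pure true := by
      obtain ⟨m, hm⟩ := s.2.support_nonempty
      intro ht
      have := Expr.distFull_eq_pure_iff.1 ht m hm
      rw [hev m hm] at this
      exact Bool.noConfusion this
    rw [dif_neg hne, dif_pos hv]
    exact h' s ⟨hs, heq⟩

theorem validJudgement_skip : ValidJudgement φ .skip φ := fun _ h => h

/-- Termination from a single memory of the support suffices: the invariant makes the guard almost
surely constant after each iteration, so one finished outcome shows that all are finished. The loop
then equals a finite iterate. -/
theorem validJudgement_loop {b : Expr D R Bool} (hwf : (Com.loop b c).WellFormed)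
    (hterm : (Com.loop b c).Terminates) (h : ValidJudgement (φ.and (.eq b (.lit true))) c φ)
    (hb : (φ.imp (.atom (.detm b))).Valid) :
    ValidJudgement φ (.loop b c) (φ.and (.eq b (.lit false))) := by
  intro s hs
  obtain ⟨F, K, hk⟩ := c.exists_hasKernel hwf.1 hterm.1
  have hdet : b.IsDet ∨ ∀ σ, F σ = σ ∧ id σ = σ := hwf.2.imp_right fun hx σ =>
    ⟨hk.mod.eq_id hx σ, rfl⟩
  have hker := (hk.sem.cond isKernel_id hdet).iterate
  have hinv : ∀ n, φ.Sat (iterSem b c.sem n s).toConfig := by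
    intro n
    induction n with
    | zero => exact hs
    | succ n ih =>
      have h1 : iterSem b c.sem (n + 1) s = condSem b c.sem id (iterSem b c.sem n s) :=
        Function.iterate_succ_apply' _ _ _
      rw [h1]
      -- One iteration is a conditional whose second branch is `skip`.
      exact validJudgement_cond h (c' := .skip) (fun _ h' => h'.1) hb _ ih
  obtain ⟨n, hn⟩ : ∃ n, b.distFull (iterSem b c.sem n s) = PMF.pure false := by
    obtain ⟨m, hm⟩ := s.2.support_nonempty
    obtain ⟨n, hn⟩ := hterm.2 s.1 m
    refine ⟨n, ?_⟩
    obtain ⟨_, v, hv⟩ := Assertion.sat_of_valid_imp hb (hinv n)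
    change b.distFull (iterSem b c.sem n s) = PMF.pure v at hv
    have e1 : iterSem b c.sem n (s.1, PMF.pure m) = _ := hker n s.1 (PMF.pure m)
    have e2 : iterSem b c.sem n s = _ := hker n s.1 s.2
    rw [PMF.pure_bind] at e1
    rw [e1] at hn
    obtain ⟨m', hm'⟩ :=
      (iterKer (condDet b F id) (condKer b K fun _ => PMF.pure) n s.1 m).support_nonempty
    have h1 := hn m' hm'
    -- An outcome reached from `m` is also an outcome of the run from `s`, so the constant value `v`
    -- of the guard can be read off there.
    have h2 := Expr.distFull_eq_pure_iff.1 hv m' (by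
      rw [e2]
      exact (PMF.mem_support_bind_iff _ _ _).2 ⟨m, hm, hm'⟩)
    rw [e2] at h2
    rw [hv, ← h2]
    exact congrArg PMF.pure h1
  have hlim : IsLoopLimit b c.sem s (iterSem b c.sem n s) := by
    intro σ m
    refine tendsto_const_nhds.congr' ?_
    filter_upwards [Filter.eventually_ge_atTop n] with k hk
    rw [iterSem_stable hn hk, abortWeight]
    split_ifs with hbm
    · rfl
    · rw [State.weight]
      split_ifs
      · by_contra hne
        exact hbm (Expr.distFull_eq_pure_iff.1 hn m hne)
      · rfl
  have hsem : (Com.loop b c).sem s = iterSem b c.sem n s := loopSem_eq_of_isLoopLimit hlim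
  rw [hsem]
  exact ⟨hinv n, b.definedOn_univ, Expr.definedOn_univ _,
    fun m hm => Expr.distFull_eq_pure_iff.1 hn m hm⟩

theorem validJudgement_dassn (x : dv) (e : Expr D R (D x)) (he : e.IsDet) :
    ValidJudgement (ψ.subst x e) (.dassn x e he) ψ :=
  fun _ hs => (Assertion.sat_subst_iff he).1 hs

theorem validJudgement_rassn (x : rv) (e : Expr D R (R x)) (hx : Sum.inr x ∉ e.fv) :
    ValidJudgement φ (.rassn x e) (.eq (.rvar x) e) := by
  intro s _
  refine ⟨Expr.definedOn_univ _, Expr.definedOn_univ _, fun m hm => ?_⟩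
  obtain ⟨m', -, hm⟩ := (PMF.mem_support_bind_iff _ _ _).1 hm
  obtain rfl := (PMF.mem_support_pure_iff _ _).1 hm
  change Function.update m' (⟨x, trivial⟩ : (Set.univ : Set rv)) (e.evalFull s.1 m') ⟨x, trivial⟩ = _
  rw [Function.update_self]
  refine e.eval_congr _ _ (fun _ _ => rfl) fun y hy => ?_
  have : (⟨y, trivial⟩ : (Set.univ : Set rv)) ≠ ⟨x, trivial⟩ := fun h => by
    obtain rfl : y = x := congrArg Subtype.val h
    exact hx hy
  exact (Function.update_of_ne this _ _).symm

theorem validJudgement_samp (x : rv) (T : Multiset (R x)) (hT : T ≠ 0) :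
    ValidJudgement φ (.samp x T hT) (.atom (.unif (.rvar x) T hT)) := by
  intro s _
  refine ⟨Expr.definedOn_univ _, ?_⟩
  change PMF.map (fun m : RMem R Set.univ => m ⟨x, trivial⟩) (s.2.bind fun m =>
    (PMF.ofMultiset T hT).bind fun v => PMF.pure (Function.update m ⟨x, trivial⟩ v)) = _
  simp only [PMF.map_bind, PMF.pure_map, Function.update_self]
  rw [PMF.bind_const]
  exact PMF.bind_pure _

theorem validJudgement_const (hk : ∃ F K, c.HasKernel F K) (h : ValidJudgement φ c ψ)
    (hη : Disjoint η.fv c.mv) : ValidJudgement (φ.and η) c (ψ.and η) := by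
  obtain ⟨F, K, hk⟩ := hk
  intro s hs
  refine ⟨h s hs.1, ?_⟩
  obtain ⟨q, -, h2, -, h4⟩ := hk.mod.exists_sat (PMem.Le.refl (PMem.full s.2)) hs.2 hη
  have e : c.sem s = _ := hk.sem s.1 s.2
  rw [e]
  exact h4.mono h2

/-- The variables in `T` and the read ones lie in the domain of the part for `φ`. With the written
ones they cover the free variables of `ψ`, so `ψ`, which holds in the whole output, descends to the
part independent of `η`. -/
theorem validJudgement_frame (hk : ∃ F K, c.HasKernel F K) (T : Finset (dv ⊕ rv))
    (h : ValidJudgement φ c ψ) (hη : Disjoint η.fv c.mv) (hψ : ψ.fv ⊆ T ∪ c.readv ∪ c.writev)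
    (hφ : (φ.imp (.inVars (T ∪ c.readv))).Valid) :
    ValidJudgement (φ.star η) c (ψ.star η) := by
  obtain ⟨F, K, hk⟩ := hk
  intro s hs
  obtain ⟨p, q, hpq, hp, hq⟩ := Assertion.sat_star_iff.1 hs
  have hdom : ∀ x, Sum.inr x ∈ T ∪ c.readv → x ∈ p.dom := fun x hx =>
    Assertion.mem_dom_of_sat_inVars (Assertion.sat_of_valid_imp hφ hp) hx
  obtain ⟨q', h1, h2, h3, h4⟩ := hk.mod.exists_sat hpq.le_right hq hη
  obtain ⟨p', h5, h6⟩ := hk.rw.indepIn (σ := s.1) hk.mod c.writev_subset_mv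
    (hpq.of_le (PMem.Le.refl p) h1)
    (fun x hx => hdom x (Finset.mem_union_right _ hx))
    (fun x hx => Finset.disjoint_left.1 hη (h3 x hx))
  have e : c.sem s = _ := hk.sem s.1 s.2
  have hout := h s (hp.mono hpq.le_left)
  rw [e] at hout ⊢
  refine Assertion.sat_star_iff.2 ⟨p', q', h6, hout.of_le h6.le_left fun x hx _ => ?_, h4⟩
  rw [h5]
  exact (Finset.mem_union.1 (hψ hx)).imp (hdom x) id

theorem validJudgement_rsampStar (x : rv) (T : Multiset (R x)) (hT : T ≠ 0)
    (hx : Sum.inr x ∉ φ.fv) :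
    ValidJudgement φ (.samp x T hT) (φ.star (.atom (.unif (.rvar x) T hT))) := by
  obtain ⟨F, K, hk⟩ := (Com.samp (D := D) x T hT).exists_hasKernel trivial trivial
  intro s hs
  have hmv : Disjoint φ.fv (Com.samp (D := D) x T hT).mv := Finset.disjoint_singleton_right.2 hx
  obtain ⟨q, h1, h2, h3, h4⟩ := hk.mod.exists_sat (PMem.Le.refl (PMem.full s.2)) hs hmv
  obtain ⟨p, h5, h6⟩ := hk.rw.indepIn (σ := s.1) hk.mod (Com.writev_subset_mv _)
    (PMem.empty_indepIn h1) (fun y hy => absurd hy (Finset.notMem_empty _))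
    (fun y hy => Finset.disjoint_left.1 hmv (h3 y hy))
  have e : (Com.samp x T hT).sem s = _ := hk.sem s.1 s.2
  have hout := validJudgement_samp (φ := φ) x T hT s hs
  rw [e] at hout ⊢
  refine Assertion.sat_star_iff.2 ⟨q, p, h6.symm, h4, hout.of_le h6.le_left fun y hy _ => ?_⟩
  rw [h5]
  have hy' : y = x := by simpa [Assertion.fv, Atom.fv, Expr.fv] using hy
  exact Or.inr (Finset.mem_singleton.2 (congrArg _ hy'))

/-- Condition on the value `n` of the part for `η`. By `CC` and `hηs` the point mass at `n`
satisfies some `ηα`; by independence the part for `φ` keeps its law. The outputs are mixed again by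
`CM`. -/
theorem validJudgement_rcase (hk : ∃ F K, c.HasKernel F K) (ηs : List (Assertion D R))
    (hη : η.CC) (hηs : (η.imp (.bigOr ηs)).ValidMem) (hψ : ψ.CM)
    (h : ∀ ηα ∈ ηs, ValidJudgement (φ.star ηα) c ψ) : ValidJudgement (φ.star η) c ψ := by
  obtain ⟨F, K, hk⟩ := hk
  intro s hs
  obtain ⟨p, q, hpq, hp, hq⟩ := Assertion.sat_star_iff.1 hs
  obtain ⟨hd, h1, h2, h3⟩ := hpq
  have hqμ : s.2.map (RMem.restrict h2) = q.μ := by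
    rw [← prodPMF_map_snd p.μ q.μ, ← h3, PMF.map_comp]
    rfl
  have e : c.sem s = _ := hk.sem s.1 s.2
  have e' : s.2.bind (K s.1) =
      q.μ.bind fun n => (condDist s.2 (RMem.restrict h2) n).bind (K s.1) := by
    rw [← PMF.bind_bind, ← hqμ, map_bind_condDist]
  rw [e, e']
  refine hψ.bind (T := Set.univ) _ _ fun n hn => ?_
  have hn' : n ∈ (s.2.map (RMem.restrict h2)).support := hqμ.symm ▸ hn
  have hor : (Assertion.bigOr ηs).Sat (s.1, ⟨q.dom, PMF.pure n⟩) :=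
    hηs s.1 q.dom n _ ⟨rfl, PMem.Le.refl _⟩ (hη _ hq n hn)
  obtain ⟨ηα, hα, hsat⟩ := Assertion.sat_bigOr_iff.1 hor
  have hout := h ηα hα (s.1, condDist s.2 (RMem.restrict h2) n)
    (Assertion.sat_star_iff.2 ⟨p, ⟨q.dom, PMF.pure n⟩, ⟨hd, h1, h2, ?_⟩, hp, hsat⟩)
  · rwa [hk.sem] at hout
  · rw [prodPMF_pure, ← map_condDist_of_indep h3 hn, PMF.map_comp]
    exact PMF.map_congr_support fun m hm =>
      Prod.ext rfl ((mem_support_condDist hn').1 hm).1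

/-- Split on `ev₁`: given `ev₁` the output probability is at most `δ`, and otherwise it is at most
one, on inputs of total weight at most `ε`. -/
theorem validJudgement_probBound (hk : ∃ F K, c.HasKernel F K) {ev₁ ev₂ : Expr D R Bool}
    {δ ε : ℝ} (hδ : 0 ≤ δ)
    (h : ValidJudgement (.atom (.event ev₁ true)) c (.atom (.prob ev₂ .le δ))) :
    ValidJudgement (.atom (.prob ev₁ .ge (1 - ε))) c (.atom (.prob ev₂ .le (δ + ε))) := by
  obtain ⟨F, K, hk⟩ := hk
  rintro ⟨σ, μ⟩ ⟨_, hs⟩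
  set ν := μ.map (ev₁.evalFull σ) with hν
  change 1 - ε ≤ (ν true).toReal at hs
  refine ⟨ev₂.definedOn_univ, ?_⟩
  rw [hk.sem]
  set κ := fun v => (condDist μ (ev₁.evalFull σ) v).bind (K σ) with hκ
  have e : μ.bind (K σ) = ν.bind κ := by
    rw [hκ, ← PMF.bind_bind, map_bind_condDist]
  change ((PMF.map (ev₂.evalFull (F σ)) (μ.bind (K σ))) true).toReal ≤ δ + ε
  rw [e, PMF.map_bind, PMF.bind_bool]
  set a := PMF.map (ev₂.evalFull (F σ)) (κ true) true
  have ha1 : a ≤ 1 := PMF.coe_le_one _ _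
  have hν1 : ν true ≤ 1 := PMF.coe_le_one _ _
  set b := PMF.map (ev₂.evalFull (F σ)) (κ false) true
  have hb1 : b ≤ 1 := PMF.coe_le_one _ _
  have key : ν true ≠ 0 → a.toReal ≤ δ := by
    intro hne
    have hout := h (σ, condDist μ (ev₁.evalFull σ) true) ⟨ev₁.definedOn_univ, fun m hm =>
      ((mem_support_condDist ((PMF.mem_support_iff _ _).2 hne)).1 hm).1⟩
    rw [hk.sem] at hout
    exact hout.2
  have hat := ne_top_of_le_ne_top ENNReal.one_ne_top ha1
  have hbt := ne_top_of_le_ne_top ENNReal.one_ne_top hb1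
  have hνt := ne_top_of_le_ne_top ENNReal.one_ne_top hν1
  rw [ENNReal.toReal_add (ENNReal.mul_ne_top hνt hat)
    (ENNReal.mul_ne_top (ENNReal.sub_ne_top ENNReal.one_ne_top) hbt), ENNReal.toReal_mul,
    ENNReal.toReal_mul, ENNReal.toReal_sub_of_le hν1 ENNReal.one_ne_top, ENNReal.toReal_one]
  have hb' : b.toReal ≤ 1 := ENNReal.toReal_mono ENNReal.one_ne_top hb1
  have hν' : (ν true).toReal ≤ 1 := ENNReal.toReal_mono ENNReal.one_ne_top hν1
  have hb0 : 0 ≤ b.toReal := ENNReal.toReal_nonneg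
  have hν0 : 0 ≤ (ν true).toReal := ENNReal.toReal_nonneg
  have h1 : (ν true).toReal * a.toReal ≤ δ := by
    -- If `ev₁` has probability zero, the premise gives nothing, and `0 ≤ δ` is needed.
    by_cases hz : ν true = 0
    · simpa [hz] using hδ
    · have := key hz
      have ha0 : 0 ≤ a.toReal := ENNReal.toReal_nonneg
      nlinarith
  nlinarith

end Rules

/-! ### Negative association and commands -/

namespace PMem

open RMem

/-- The defining inequality of partition negative association for a family of unions of blocks,
which may have repeated empty members and need not cover all blocks. -/
theorem IsPNA.tsum_prod_le [∀ x, Preorder (R x)] {p : PMem R} {𝒮 : Finset (Set rv)}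
    (h : p.IsPNA 𝒮) {ι : Type} [Fintype ι] {t : ι → Set rv}
    (hd : ∀ i j, i ≠ j → Disjoint (t i) (t j))
    (hb : ∀ i, ∃ ℛ : Finset (Set rv), ℛ ⊆ 𝒮 ∧ t i = ⋃₀ (ℛ : Set (Set rv)))
    (ht : ∀ i, t i ⊆ p.dom) (f : ∀ i, RMem R (t i) → ℝ≥0)
    (hf : (∀ i, Monotone (f i)) ∨ ∀ i, Antitone (f i)) :
    ∑' m, p.μ m * ∏ i, (f i (restrict (ht i) m) : ℝ≥0∞) ≤
      ∏ i, ∑' m, p.μ m * (f i (restrict (ht i) m) : ℝ≥0∞) := by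
  obtain ⟨hpart, hdom, hineq⟩ := h
  -- The uncovered variables become one more member, so that `𝒯` covers all blocks.
  set L : Set rv := ⋃₀ (𝒮 : Set (Set rv)) \ ⋃ i, t i with hL
  set 𝒯 : Finset (Set rv) := insert L (Finset.univ.image t) with h𝒯
  have hmem : ∀ i, t i ∈ 𝒯 := fun i =>
    Finset.mem_insert_of_mem (Finset.mem_image_of_mem _ (Finset.mem_univ i))
  have hsub : ∀ i, t i ⊆ ⋃₀ (𝒮 : Set (Set rv)) := by
    intro i
    obtain ⟨ℛ, h1, h2⟩ := hb i
    rw [h2]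
    exact Set.sUnion_subset_sUnion (Finset.coe_subset.2 h1)
  have hLd : ∀ i, Disjoint L (t i) := fun i =>
    Set.disjoint_left.2 fun x hx hxi => hx.2 (Set.mem_iUnion_of_mem i hxi)
  have hcoarse : Coarsens 𝒯 𝒮 := by
    refine ⟨?_, ?_, ?_⟩
    · intro A hA B hB hAB
      rw [Finset.mem_coe, h𝒯, Finset.mem_insert, Finset.mem_image] at hA hB
      change Disjoint A B
      rcases hA with rfl | ⟨i, -, rfl⟩ <;> rcases hB with rfl | ⟨j, -, rfl⟩
      · exact absurd rfl hAB
      · exact hLd j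
      · exact (hLd i).symm
      · exact hd i j fun hij => hAB (hij ▸ rfl)
    · apply subset_antisymm
      · refine Set.sUnion_subset fun A hA => ?_
        rw [Finset.mem_coe, h𝒯, Finset.mem_insert, Finset.mem_image] at hA
        rcases hA with rfl | ⟨i, -, rfl⟩
        · exact Set.sdiff_subset
        · exact hsub i
      · intro x hx
        by_cases hxt : x ∈ ⋃ i, t i
        · obtain ⟨i, hi⟩ := Set.mem_iUnion.1 hxt
          exact ⟨t i, hmem i, hi⟩
        · exact ⟨L, Finset.mem_insert_self _ _, hx, hxt⟩
    · intro A hA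
      rw [h𝒯, Finset.mem_insert, Finset.mem_image] at hA
      rcases hA with rfl | ⟨i, -, rfl⟩
      -- As blocks are disjoint and each `t i` is a union of blocks, a block that meets `t i` lies
      -- inside it.
      · refine ⟨𝒮.filter fun A => Disjoint A (⋃ i, t i), Finset.filter_subset _ _, ?_⟩
        ext x
        constructor
        · rintro ⟨⟨A, hA, hxA⟩, hx⟩
          refine ⟨A, Finset.mem_coe.2 (Finset.mem_filter.2 ⟨hA, ?_⟩), hxA⟩
          refine Set.disjoint_left.2 fun y hyA hy => hx ?_
          obtain ⟨i, hi⟩ := Set.mem_iUnion.1 hy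
          refine Set.mem_iUnion.2 ⟨i, ?_⟩
          obtain ⟨ℛ, h1, h2⟩ := hb i
          rw [h2] at hi ⊢
          obtain ⟨B, hB, hyB⟩ := hi
          have hAB : A = B := hpart.elim hA (h1 hB) fun hdis =>
            Set.disjoint_left.1 hdis hyA hyB
          exact ⟨B, hB, hAB ▸ hxA⟩
        · rintro ⟨A, hA, hxA⟩
          obtain ⟨h1, h2⟩ := Finset.mem_filter.1 (Finset.mem_coe.1 hA)
          exact ⟨⟨A, h1, hxA⟩, fun hx => Set.disjoint_left.1 h2 hxA hx⟩
      · exact hb i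
  -- Equal members are merged in the finite set `𝒯`, so the functions of all indices with `t i = A`
  -- are multiplied; a member that is no `t i` gets the constant one.
  let g : ∀ A : Set rv, RMem R A → ℝ≥0 := fun A m =>
    ∏ i, if h : t i = A then f i (restrict h.subset m) else 1
  have hg : (∀ A : 𝒯, Monotone (g A)) ∨ ∀ A : 𝒯, Antitone (g A) := by
    refine hf.imp (fun hf A m m' hm => ?_) (fun hf A m m' hm => ?_)
    all_goals
      refine Finset.prod_le_prod' fun i _ => ?_
      split_ifs
      · exact hf i fun x => hm _
      · exact le_rfl
  have key := hineq 𝒯 hcoarse (hcoarse.subset hdom) (fun A => g A) hg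
  have hgE : ∀ (A : 𝒯) (m : RMem R p.dom),
      (g A (restrict (hcoarse.subset hdom A.1 A.2) m) : ℝ≥0∞) =
        ∏ i, if t i = A.1 then (f i (restrict (ht i) m) : ℝ≥0∞) else 1 := by
    intro A m
    simp only [g, ENNReal.ofNNReal_finsetProd]
    refine Finset.prod_congr rfl fun i _ => ?_
    split_ifs
    · rfl
    · rfl
  have hswap : ∀ a : ι → ℝ≥0∞, ∏ A : 𝒯, ∏ i, (if t i = A.1 then a i else 1) = ∏ i, a i := by
    intro a
    rw [Finset.prod_comm]
    refine Finset.prod_congr rfl fun i _ => ?_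
    rw [Finset.prod_eq_single ⟨t i, hmem i⟩]
    · simp
    · intro A _ hA
      rw [if_neg fun h => hA (Subtype.ext h.symm)]
    · simp
  simp only [hgE, hswap] at key
  refine key.trans (le_of_eq ?_)
  rw [← hswap]
  refine Finset.prod_congr rfl fun A _ => ?_
  obtain ⟨m₀, -⟩ := p.μ.support_nonempty
  -- The product leaves the expectation because repeated members are empty, with constant functions,
  -- and a non-empty member has a single index.
  by_cases hex : ∃ i, t i = A.1
  · obtain ⟨i, hi⟩ := hex
    by_cases hne : A.1 = ∅
    · have hc : ∀ j, t j = A.1 → ∀ m, f j (restrict (ht j) m) = f j (restrict (ht j) m₀) := by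
        intro j hj m
        congr 1
        funext x
        exact ((hj.trans hne).subset x.2).elim
      have h1 : ∀ m, (∏ j, if t j = A.1 then (f j (restrict (ht j) m) : ℝ≥0∞) else 1) =
          ∏ j, if t j = A.1 then (f j (restrict (ht j) m₀) : ℝ≥0∞) else 1 := fun m => by
        refine Finset.prod_congr rfl fun j _ => ?_
        split_ifs with hj
        · rw [hc j hj]
        · rfl
      simp only [h1, PMF.tsum_mul_const]
      refine Finset.prod_congr rfl fun j _ => ?_
      split_ifs with hj
      · simp only [hc j hj, PMF.tsum_mul_const]
      · rfl
    · have huniq : ∀ j, j ≠ i → t j ≠ A.1 := by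
        intro j hji hj
        have := hd j i hji
        rw [hj, hi, disjoint_self] at this
        exact hne this
      have h1 : ∀ a : ι → ℝ≥0∞, ∏ j, (if t j = A.1 then a j else 1) = a i := by
        intro a
        rw [Finset.prod_eq_single i]
        · rw [if_pos hi]
        · intro j _ hj
          rw [if_neg (huniq j hj)]
        · simp
      simp only [h1]
  · push Not at hex
    simp only [hex, if_false, Finset.prod_const_one, mul_one, p.μ.tsum_coe]

/-- A single block is negatively associated. -/
theorem isPNA_singleton [∀ x, Preorder (R x)] {p : PMem R} {X : Set rv} (hX : X ⊆ p.dom) :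
    p.IsPNA {X} := by
  refine ⟨by simp [IsPartition], by simpa using hX, fun 𝒯 h𝒯 hT f hf => ?_⟩
  obtain ⟨m₀, -⟩ := p.μ.support_nonempty
  -- Functions on an empty member are constant, so at most one factor is random and the inequality
  -- is an equality.
  have hcases : ∀ A : 𝒯, A.1 = ∅ ∨ A.1 = X := by
    intro A
    obtain ⟨ℛ, h1, h2⟩ := h𝒯.2.2 A.1 A.2
    rcases Finset.subset_singleton_iff.1 h1 with rfl | rfl
    · left
      simpa using h2
    · right
      simpa using h2
  have hc : ∀ A : 𝒯, A.1 = ∅ → ∀ m, f A (restrict (hT A.1 A.2) m) =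
      f A (restrict (hT A.1 A.2) m₀) := by
    intro A hA m
    congr 1
    funext x
    exact (hA.subset x.2).elim
  by_cases hXT : ∃ A : 𝒯, A.1 = X
  · obtain ⟨A₀, hA₀⟩ := hXT
    have hne : ∀ A, A ≠ A₀ → A.1 = ∅ := fun A hA => (hcases A).resolve_right fun h =>
      hA (Subtype.ext (h.trans hA₀.symm))
    rw [← Finset.mul_prod_erase _ _ (Finset.mem_univ A₀)]
    have h1 : ∀ m, ∏ A : 𝒯, (f A (restrict (hT A.1 A.2) m) : ℝ≥0∞) =
        f A₀ (restrict (hT A₀.1 A₀.2) m) *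
          ∏ A ∈ Finset.univ.erase A₀, (f A (restrict (hT A.1 A.2) m₀) : ℝ≥0∞) := by
      intro m
      rw [← Finset.mul_prod_erase _ _ (Finset.mem_univ A₀)]
      congr 1
      refine Finset.prod_congr rfl fun A hA => ?_
      rw [hc A (hne A (Finset.ne_of_mem_erase hA))]
    simp only [h1, ← mul_assoc, ENNReal.tsum_mul_right]
    refine le_of_eq (congrArg _ (Finset.prod_congr rfl fun A hA => ?_))
    simp only [hc A (hne A (Finset.ne_of_mem_erase hA))]
    rw [ENNReal.tsum_mul_right, p.μ.tsum_coe, one_mul]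
  · have hne : ∀ A : 𝒯, A.1 = ∅ := fun A => (hcases A).resolve_right fun h => hXT ⟨A, h⟩
    have h1 : ∀ m, ∏ A : 𝒯, (f A (restrict (hT A.1 A.2) m) : ℝ≥0∞) =
        ∏ A : 𝒯, (f A (restrict (hT A.1 A.2) m₀) : ℝ≥0∞) := fun m =>
      Finset.prod_congr rfl fun A _ => by rw [hc A (hne A)]
    simp only [h1, PMF.tsum_mul_const]
    refine le_of_eq (Finset.prod_congr rfl fun A _ => ?_)
    simp only [hc A (hne A), PMF.tsum_mul_const]

/-- Replacing the block `X` by at most one variable whose value is a monotone function of `X`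
preserves negative association. -/
theorem IsPNA.of_monotone_value [∀ x, Preorder (R x)] {μ : PMF (RMem R Set.univ)}
    {K : RMem R Set.univ → PMF (RMem R Set.univ)} {X Y B : Set rv} (hXB : Disjoint X B)
    (hYB : Disjoint Y B) (hY : Y.Subsingleton) {val : RMem R X → RMem R Y} (hval : Monotone val)
    (hout : ∀ m ∈ μ.support, ∀ m' ∈ (K m).support,
      restrict (Set.subset_univ Y) m' = val (restrict (Set.subset_univ X) m) ∧
        restrict (Set.subset_univ B) m' = restrict (Set.subset_univ B) m)
    {𝒮 𝒯 : Finset (Set rv)} (hS : IsPartition 𝒮) (hSY : ∀ A ∈ 𝒮, A ⊆ Y) (hTB : ∀ A ∈ 𝒯, A ⊆ B)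
    (h : (full μ).IsPNA ({X} ∪ 𝒯)) : (full (μ.bind K)).IsPNA (𝒮 ∪ 𝒯) := by
  have hT : IsPartition 𝒯 := Set.PairwiseDisjoint.subset h.1
    (Finset.coe_subset.2 Finset.subset_union_right)
  refine ⟨?_, fun _ _ => Set.subset_univ _, fun 𝒰 h𝒰 hU f hf => ?_⟩
  · intro A hA C hC hAC
    rw [Finset.mem_coe, Finset.mem_union] at hA hC
    rcases hA with hA | hA <;> rcases hC with hC | hC
    · exact hS hA hC hAC
    · exact hYB.mono (hSY A hA) (hTB C hC)
    · exact (hYB.mono (hSY C hC) (hTB A hA)).symm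
    · exact hT hA hC hAC
  have hsub : ∀ A ∈ 𝒰, A ⊆ Y ∪ B := h𝒰.subset fun A hA =>
    (Finset.mem_union.1 hA).elim (fun hA => (hSY A hA).trans Set.subset_union_left)
      fun hA => (hTB A hA).trans Set.subset_union_right
  -- Pull each member back to the input by replacing the variable in `Y`, if present, with the whole
  -- block `X`. As `Y` has at most one element, only one member receives `X`, and the results stay
  -- disjoint.
  let t : 𝒰 → Set rv := fun A => (A.1 ∩ B) ∪ {x | x ∈ X ∧ ¬ Disjoint A.1 Y}
  have hXt : ∀ (A : 𝒰) x, x ∈ A.1 → x ∈ Y → X ⊆ t A := fun A x hA hY y hy =>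
    Or.inr ⟨hy, fun hd => Set.disjoint_left.1 hd hA hY⟩
  -- The output memory on `A` as a monotone function of the input on `t A`; test functions composed
  -- with it keep their monotonicity or antitonicity.
  let lift : ∀ A : 𝒰, RMem R (t A) → RMem R A.1 := fun A m x =>
    if hx : x.1 ∈ Y then val (restrict (hXt A x.1 x.2 hx) m) ⟨x.1, hx⟩
    else m ⟨x.1, Or.inl ⟨x.2, (hsub A.1 A.2 x.2).resolve_left hx⟩⟩
  have hlift : ∀ A, Monotone (lift A) := by
    intro A m m' hm x
    simp only [lift]
    split_ifs
    · exact hval (fun y => hm _) _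
    · exact hm _
  have hrestr : ∀ (A : 𝒰), ∀ m ∈ μ.support, ∀ m' ∈ (K m).support,
      restrict (Set.subset_univ A.1) m' = lift A (restrict (Set.subset_univ _) m) := by
    intro A m hm m' hm'
    obtain ⟨h1, h2⟩ := hout m hm m' hm'
    funext x
    simp only [lift]
    split_ifs with hx
    · exact congrFun h1 ⟨x.1, hx⟩
    · exact congrFun h2 ⟨x.1, (hsub A.1 A.2 x.2).resolve_left hx⟩
  -- Quantities fixed by the input have the same expectation before and after the kernel.
  have hE : ∀ g g' : RMem R Set.univ → ℝ≥0∞,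
      (∀ m ∈ μ.support, ∀ m' ∈ (K m).support, g m' = g' m) →
        ∑' m, (μ.bind K) m * g m = ∑' m, μ m * g' m := by
    intro g g' hg
    rw [PMF.tsum_bind_mul]
    refine PMF.tsum_congr_support fun m hm => ?_
    rw [PMF.tsum_congr_support (g' := fun _ => g' m) (hg m hm), PMF.tsum_mul_const]
  have hdisj : ∀ A C : 𝒰, A ≠ C → Disjoint (t A) (t C) := by
    intro A C hAC
    have hd : Disjoint A.1 C.1 := h𝒰.1 A.2 C.2 fun h => hAC (Subtype.ext h)
    refine Set.disjoint_left.2 fun x hA hC => ?_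
    rcases hA with hA | ⟨hA, hA'⟩ <;> rcases hC with hC | ⟨hC, hC'⟩
    · exact Set.disjoint_left.1 hd hA.1 hC.1
    · exact Set.disjoint_left.1 hXB hC hA.2
    · exact Set.disjoint_left.1 hXB hA hC.2
    · obtain ⟨y, hy, hyY⟩ := Set.not_disjoint_iff.1 hA'
      obtain ⟨z, hz, hzY⟩ := Set.not_disjoint_iff.1 hC'
      exact Set.disjoint_left.1 hd hy (hY hyY hzY ▸ hz)
  have hblock : ∀ A : 𝒰, ∃ ℛ : Finset (Set rv), ℛ ⊆ {X} ∪ 𝒯 ∧ t A = ⋃₀ (ℛ : Set (Set rv)) := by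
    intro A
    obtain ⟨ℛ, h1, h2⟩ := h𝒰.2.2 A.1 A.2
    have h3 : A.1 ∩ B = ⋃₀ ((ℛ.filter (· ∈ 𝒯) : Finset (Set rv)) : Set (Set rv)) := by
      ext x
      constructor
      · rintro ⟨hxA, hxB⟩
        rw [h2] at hxA
        obtain ⟨C, hC, hxC⟩ := hxA
        refine ⟨C, Finset.mem_coe.2 (Finset.mem_filter.2 ⟨hC, ?_⟩), hxC⟩
        exact (Finset.mem_union.1 (h1 hC)).resolve_left fun hCS =>
          Set.disjoint_left.1 hYB (hSY C hCS hxC) hxB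
      · rintro ⟨C, hC, hxC⟩
        obtain ⟨hC, hC'⟩ := Finset.mem_filter.1 (Finset.mem_coe.1 hC)
        exact ⟨h2 ▸ ⟨C, hC, hxC⟩, hTB C hC' hxC⟩
    have h4 : ℛ.filter (· ∈ 𝒯) ⊆ 𝒯 := fun C hC => (Finset.mem_filter.1 hC).2
    by_cases hAY : Disjoint A.1 Y
    · refine ⟨ℛ.filter (· ∈ 𝒯), h4.trans Finset.subset_union_right, ?_⟩
      rw [← h3]
      simp [t, hAY]
    · refine ⟨{X} ∪ ℛ.filter (· ∈ 𝒯), Finset.union_subset_union_right h4, ?_⟩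
      rw [Finset.coe_union, Set.sUnion_union, ← h3, Set.union_comm]
      simp [t, hAY]
  have key := h.tsum_prod_le hdisj hblock (fun A => Set.subset_univ _)
    (fun A m => f A (lift A m))
    (hf.imp (fun hf A => (hf A).comp (hlift A)) fun hf A => (hf A).comp_monotone (hlift A))
  refine le_of_eq_of_le (hE _ _ fun m hm m' hm' => ?_) (key.trans_eq ?_)
  · exact Finset.prod_congr rfl fun A _ =>
      congrArg (fun x => (f A x : ℝ≥0∞)) (hrestr A m hm m' hm')
  · refine Finset.prod_congr rfl fun A _ => (hE _ _ fun m hm m' hm' => ?_).symm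
    exact congrArg (fun x => (f A x : ℝ≥0∞)) (hrestr A m hm m' hm')

end PMem

/-- The variables in `X` are read and not modified: the randomized ones lie in the part for `φ`, and
`y = f(X)` refers to their initial values. The only property used of that part is that `X` is a
negatively associated block of its own; in it, `X` is then replaced by `y`. -/
theorem validJudgement_negFrame [∀ x, Preorder (D x)] [∀ x, Preorder (R x)]
    {φ η : Assertion D R} {c : Com D R} (hk : ∃ F K, c.HasKernel F K)
    (X : Finset (dv ⊕ rv)) (y : dv ⊕ rv) (f : Expr D R (VarTy D R y))
    (hφ : (φ.imp (.inVars c.readv)).Valid) (hη : Disjoint η.fv c.mv) (hX : X ⊆ c.readv \ c.mv)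
    (hy : y ∉ η.fv) (hfX : f.fv ⊆ X) (hf : f.IsMonotone)
    (h : ValidJudgement φ c (.eq (.var y) f)) :
    ValidJudgement (φ.nstar η) c (.nstar (.isIn (.var y)) η) := by
  obtain ⟨F, K, hk⟩ := hk
  rintro ⟨σ, μ⟩ hs
  obtain ⟨p, q, ⟨hd, hp1, hq1, hneg⟩, hp, hq⟩ := Assertion.sat_nstar_iff.1 hs
  have hread : ∀ x, Sum.inr x ∈ c.readv → x ∈ p.dom := fun x hx =>
    Assertion.mem_dom_of_sat_inVars (Assertion.sat_of_valid_imp hφ hp) hx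
  have hXread : ∀ x, x ∈ X → x ∈ c.readv ∧ x ∉ c.mv := fun x hx =>
    Finset.mem_sdiff.1 (hX hx)
  obtain ⟨q', h1, h2, h3, h4⟩ := hk.mod.exists_sat hq1 hq hη
  have hout := h (σ, μ) (hp.mono hp1)
  rw [hk.sem] at hout ⊢
  obtain ⟨_, _, hout⟩ := hout
  set Xr : Set rv := {x | Sum.inr x ∈ X} with hXr
  set Y : Set rv := {x | Sum.inr x = y} with hYdef
  have hXp : Xr ⊆ p.dom := fun x hx => hread x (hXread _ hx).1
  have hYs : Y.Subsingleton := fun a ha b hb => Sum.inr_injective (ha.trans hb.symm)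
  have hfXr : f.DefinedOn Xr := fun x hx => hfX hx
  have hdY : Disjoint Y q'.dom := Set.disjoint_left.2 fun x hx hxq => hy (hx ▸ h3 x hxq)
  have hval : ∃ val : RMem R Xr → RMem R Y, Monotone val ∧
      ∀ m ∈ (μ.bind (K σ)).support,
        RMem.restrict (Set.subset_univ Y) m = val (RMem.restrict (Set.subset_univ Xr) m) := by
    -- For a deterministic `y` the set `Y` is empty and the function `val` is trivial.
    cases y with
    | inl y =>
      exact ⟨fun _ x => absurd x.2 Sum.inr_ne_inl, fun _ _ _ x => absurd x.2 Sum.inr_ne_inl,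
        fun m _ => funext fun x => absurd x.2 Sum.inr_ne_inl⟩
    | inr y =>
      refine ⟨fun m x => cast (congrArg R (Sum.inr_injective x.2).symm) (f.eval (F σ) m hfXr),
        fun m m' hm x => ?_, fun m hm => funext fun x => ?_⟩
      · obtain ⟨x, hx⟩ := x
        obtain rfl : x = y := Sum.inr_injective hx
        exact hf Xr hfXr _ _ m m' le_rfl hm
      · obtain ⟨x, hx⟩ := x
        obtain rfl : x = y := Sum.inr_injective hx
        refine (hout m hm).trans ?_
        exact f.eval_congr _ _ (fun _ _ => rfl) fun _ _ => rfl
  obtain ⟨val, hmono, hval⟩ := hval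
  refine Assertion.sat_nstar_iff.2 ⟨(PMem.full (μ.bind (K σ))).res Y, q',
    ⟨?_, PMem.res_le _ _, h2, fun 𝒮 𝒯 hS hT => ?_⟩, ?_, h4⟩
  · exact hdY.mono_left Set.inter_subset_left
  · have hT' : q.IsPNA 𝒯 := (PMem.isPNA_iff_of_le h1 hT.2.1).1 hT
    have hall := hneg _ _ (PMem.isPNA_singleton hXp) hT'
    refine PMem.IsPNA.of_monotone_value (hd.mono hXp h1.1) hdY hYs hmono
      (fun m hm m' hm' => ⟨?_, ?_⟩) hS.1 (fun A hA => (hS.2.1 A hA).trans Set.inter_subset_left)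
      hT.2.1 hall
    · rw [hval m' ((PMF.mem_support_bind_iff _ _ _).2 ⟨m, hm, hm'⟩)]
      congr 1
      funext x
      exact hk.mod.rand σ m m' hm' ⟨x.1, trivial⟩ (hXread _ x.2).2
    · funext x
      exact hk.mod.rand σ m m' hm' ⟨x.1, trivial⟩ (Finset.disjoint_left.1 hη (h3 _ x.2))
  · have hdef : (Expr.var (D := D) (R := R) y).DefinedOn ((PMem.full (μ.bind (K σ))).res Y).dom := by
      intro x hx
      refine ⟨?_, trivial⟩
      cases y with
      | inl y => simp [Expr.var, Expr.fv] at hx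
      | inr y => simpa [Expr.var, Expr.fv, hYdef] using hx
    exact ⟨hdef, hdef, fun _ _ => rfl⟩

/-- Derivable judgements are valid. -/
theorem Derivable.validJudgement [∀ x, Preorder (D x)] [∀ x, Preorder (R x)]
    {φ ψ : Assertion D R} {c : Com D R} (hder : Derivable φ c ψ) (hwf : c.WellFormed)
    (hterm : c.Terminates) : ValidJudgement φ c ψ := by
  induction hder with
  | dassn x e he ψ => exact validJudgement_dassn x e he
  | skip φ => exact validJudgement_skip
  | seqn _ _ ih ih' => exact fun s hs => ih' hwf.2 hterm.2 _ (ih hwf.1 hterm.1 s hs)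
  | cond _ _ hb ih ih' =>
    exact validJudgement_cond (ih hwf.1 hterm.1) (ih' hwf.2.1 hterm.2) hb
  | loop _ hb ih => exact validJudgement_loop hwf hterm (ih hwf.1 hterm.1) hb
  | rassn x e hx => exact validJudgement_rassn x e hx
  | rsamp x T hT => exact validJudgement_samp x T hT
  | rsampStar φ x T hT hx => exact validJudgement_rsampStar x T hT hx
  | weak _ hv ih =>
    exact fun s hs => Assertion.sat_of_valid_imp (fun γ => (hv γ).2)
      (ih hwf hterm s (Assertion.sat_of_valid_imp (fun γ => (hv γ).1) hs))
  | triv c => exact fun _ _ => trivial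
  | conj _ _ ih ih' => exact fun s hs => ⟨ih hwf hterm s hs.1, ih' hwf hterm s hs.2⟩
  | case _ _ ih ih' => exact fun s hs => hs.imp (ih hwf hterm s) (ih' hwf hterm s)
  | const _ hη ih =>
    exact validJudgement_const (Com.exists_hasKernel _ hwf hterm) (ih hwf hterm) hη
  | frame T _ hη hψ hφ ih =>
    exact validJudgement_frame (Com.exists_hasKernel _ hwf hterm) T (ih hwf hterm) hη hψ hφ
  | rcase ηs hη hηs hψ _ ih =>
    exact validJudgement_rcase (Com.exists_hasKernel _ hwf hterm) ηs hη hηs hψ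
      fun ηα hα => ih ηα hα hwf hterm
  | negFrame X y f hφ hη hX hy hfX hf _ ih =>
    exact validJudgement_negFrame (Com.exists_hasKernel _ hwf hterm) X y f hφ hη hX hy hfX hf
      (ih hwf hterm)
  | probBound hδ _ ih =>
    exact validJudgement_probBound (Com.exists_hasKernel _ hwf hterm) hδ (ih hwf hterm)

end Lina

end

theorem mainTheorem1 {dv rv : Type} {D : dv → Type} {R : rv → Type}
    [∀ x, Preorder (D x)] [∀ x, Preorder (R x)]
    (φ ψ : Lina.Assertion D R) (c : Lina.Com D R)
    (hwf : c.WellFormed) (hterm : c.Terminates)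
    (hder : Lina.Derivable φ c ψ) :
    Lina.ValidJudgement φ c ψ :=
  hder.validJudgement hwf hterm
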